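/- **Setting.** An operational probabilistic theory (OPT) consists of systems and events that form a symmetric monoidal category (sequential composition $\circ$, parallel composition $\boxtimes$, trivial system $\mathrm I$, systems may be permuted), of a class of finite families of events called tests, closed under relabelling of outcomes, sequential and parallel composition and coarse-graining (merging of outcomes, the merged event being the sum of the events it replaces), such that every event belongs to a test and the identities and canonical isomorphisms are deterministic (a deterministic event is one that forms a one-element test), and of probabilities for the events $\mathrm I\to\mathrm I$ which are nonnegative, sum to $1$ over each test, and are multiplicative. Every system has at least one event $\mathrm I\to A$ and one event $A\to\mathrm I$. Events are identified (as *transformations*) when they give equal probabilities in every closed circuit, with any ancilla. *States* of $A$ are the events $\mathrm I\to A$ and *effects* the events $A\to\mathrm I$, up to this identification; $\mathsf{St}_{\mathbb R}(A)$ is the real span of the states, as functionals on effects, and $D_A=\dim \mathsf{St}_{\mathbb R}(A)$. We assume that every $\mathsf{St}_{\mathbb R}(A)$ is finite-dimensional and that the set $\mathsf{St}(A)$ of states is closed in it. $\|x\|_{\rm op}=\sup_a (2a-e\,|\,x)$, over all effects $a$, with $e$ the deterministic effect. A *refinement* of a state $\rho$ is a subfamily $\{\rho_i\}_{i\in Y}$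 of a test of events $\mathrm I\to A$ with $\sum_{i\in Y}\rho_i=\rho$. The state $\rho$ is *pure* if in each of its refinements every $\rho_i$ equals $\lambda_i\rho$ for some $\lambda_i\in[0,1]$. A *dilation* of $\rho\in\mathsf{St}(A)$ is a state $\Psi$ of some $AC$ such that $\rho$ is obtained from $\Psi$ by applying a deterministic effect on $C$; a *purification* is a pure dilation. A transformation is *reversible* if it has a two-sided inverse transformation. The OPT is *strongly causal* if for every test $\{\mathcal A_i\}_{i\in X}$ from $A$ to $B$ and tests $\{\mathcal B^i_j\}_{j\in Y_i}$ from $B$ to $C$ ($i\in X$), the family $\{\mathcal B^i_j\circ\mathcal A_i\}_{i\in X,\,j\in Y_i}$ is a test. It satisfies *regular scaling* if for each $A$ there is $k_A>0$ with $D_{A^{\boxtimes N}}\le k_A D_A^N$ for all $N$. It satisfies *essential uniqueness of purification* if for any two purifications $\Phi,\Psi\in\mathsf{St}(AC)$ of the same state of $A$ there is a reversible transformation $\mathcal U$ of $C$ with $\Psi=(\mathcal I_A\boxtimes\mathcal U)\Phi$. It satisfies *atomicity of parallel composition of states* if $\phi\boxtimes\psi$ is pure for all pure states $\phi,\psi$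 of any systems. An *obit* is a system $B$ such that for every system $A$ there are $k<\infty$ and deterministic transformations $\mathcal E:A\to B^{\boxtimes k}$, $\mathcal D:B^{\boxtimes k}\to A$ with $\mathcal D\mathcal E=\mathcal I_A$. For a deterministic state $\rho$ of $A$, let $E_{N,M,\varepsilon}(\rho)$ be the set of pairs of deterministic transformations $\mathcal E:A^{\boxtimes N}\to B^{\boxtimes M}$, $\mathcal D:B^{\boxtimes M}\to A^{\boxtimes N}$ such that $$\sup\ \sum_{i}\big\|(\mathcal D\mathcal E\boxtimes\mathcal I_C)\Psi_i-\Psi_i\big\|_{\rm op}<\varepsilon ,$$ the supremum being over all systems $C$ and all refinements $\{\Psi_i\}$ of dilations of $\rho^{\boxtimes N}$ in $\mathsf{St}(A^{\boxtimes N}C)$. The *information content* of $\rho$ is $$I(\rho)=\lim_{\varepsilon\to0^+}\ \limsup_{N\to\infty}\ \frac{\min\{M\ge1: E_{N,M,\varepsilon}(\rho)\ne\emptyset\}}{N}.$$ **Proposition.** Consider a strongly causal OPT as above that satisfies regular scaling, and let $B$ be an obit, with respect to which $I$ is computed. 1. If the OPT satisfies essential uniqueness of purification and atomicity of parallel composition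 of states, then $I(\phi)=0$ for every system $A$ and every deterministic pure state $\phi$ of $A$. 2. Conversely, if $I(\phi)=0$ for every system $A$ and every deterministic pure state $\phi$ of $A$, then the OPT satisfies atomicity of parallel composition of states. -/

import Mathlib

open CategoryTheory MonoidalCategory Filter Topology
open scoped ENNReal

universe v u

noncomputable section

/-- An operational probabilistic theory. Systems are the objects and events are the morphisms of a
symmetric monoidal category (sequential composition is composition, parallel composition is the
tensor product, the trivial system is the unit object, and systems may be permuted). On top of this,
the theory says which finite collections of events are tests, and it assigns a probability to every
event from the trivial system to itself. -/
structure OPT (S : Type u) [Category.{v} S] [MonoidalCategory S] [SymmetricCategory S] where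
  /-- `IsTest t` says that the finite collection of events `t` is a test. -/
  IsTest : ∀ {A B : S} {X : Type} [Finite X], (X → (A ⟶ B)) → Prop
  /-- The probability of a closed circuit. -/
  prob : (𝟙_ S ⟶ 𝟙_ S) → ℝ
  /-- Every event occurs in some test. -/
  event_mem_test : ∀ {A B : S} (f : A ⟶ B), ∃ (X : Type) (_ : Finite X) (t : X → (A ⟶ B)) (x : X),
    IsTest t ∧ t x = f
  /-- Relabelling the outcomes of a test. -/
  test_relabel : ∀ {A B : S} {X Y : Type} [Finite X] [Finite Y] (t : X → (A ⟶ B)) (r : Y ≃ X),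
    IsTest t → IsTest fun y => t (r y)
  /-- Sequential composition of tests. -/
  test_comp : ∀ {A B C : S} {X Y : Type} [Finite X] [Finite Y] (t : X → (A ⟶ B)) (s : Y → (B ⟶ C)),
    IsTest t → IsTest s → IsTest fun p : X × Y => t p.1 ≫ s p.2
  /-- Parallel composition of tests. -/
  test_tensor : ∀ {A B C D : S} {X Y : Type} [Finite X] [Finite Y] (t : X → (A ⟶ B))
    (s : Y → (C ⟶ D)), IsTest t → IsTest s → IsTest fun p : X × Y => t p.1 ⊗ₘ s p.2
  /-- The identity and the canonical isomorphisms that rebracket, remove or insert trivial systems,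
  and permute systems are deterministic. -/
  test_id : ∀ A : S, IsTest fun _ : Unit => 𝟙 A
  test_associator_hom : ∀ A B C : S, IsTest fun _ : Unit => (α_ A B C).hom
  test_associator_inv : ∀ A B C : S, IsTest fun _ : Unit => (α_ A B C).inv
  test_leftUnitor_hom : ∀ A : S, IsTest fun _ : Unit => (λ_ A).hom
  test_leftUnitor_inv : ∀ A : S, IsTest fun _ : Unit => (λ_ A).inv
  test_rightUnitor_hom : ∀ A : S, IsTest fun _ : Unit => (ρ_ A).hom
  test_rightUnitor_inv : ∀ A : S, IsTest fun _ : Unit => (ρ_ A).inv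
  test_braiding : ∀ A B : S, IsTest fun _ : Unit => (β_ A B).hom
  /-- A test from the trivial system to itself is a probability distribution. -/
  prob_nonneg : ∀ s : 𝟙_ S ⟶ 𝟙_ S, 0 ≤ prob s
  sum_prob : ∀ {X : Type} [Fintype X] (t : X → (𝟙_ S ⟶ 𝟙_ S)), IsTest t → ∑ x, prob (t x) = 1
  /-- Closed circuits are independent. -/
  prob_comp : ∀ s t : 𝟙_ S ⟶ 𝟙_ S, prob (s ≫ t) = prob s * prob t
  /-- Outcomes of a test may be merged: the coarse-graining of a test is a test, each of whose
  events is, in every circuit, the sum of the events that are merged into it. -/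
  coarse_grain : ∀ {A B : S} {X Y : Type} [Fintype X] [Finite Y] [DecidableEq Y] (t : X → (A ⟶ B))
    (r : X → Y), IsTest t → Function.Surjective r → ∃ s : Y → (A ⟶ B), IsTest s ∧
      ∀ (y : Y) (C : S) (Ψ : 𝟙_ S ⟶ A ⊗ C) (a : B ⊗ C ⟶ 𝟙_ S),
        prob (Ψ ≫ s y ▷ C ≫ a) = ∑ x with r x = y, prob (Ψ ≫ t x ▷ C ≫ a)
  /-- Every system can be prepared and observed. -/
  nonempty_preparation : ∀ A : S, Nonempty (𝟙_ S ⟶ A)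
  nonempty_observation : ∀ A : S, Nonempty (A ⟶ 𝟙_ S)

namespace OPT

variable {S : Type u} [Category.{v} S] [MonoidalCategory S] [SymmetricCategory S] (T : OPT S)

/-! ### Events, transformations and states -/

/-- An event is deterministic if it is the only event of a test. -/
def IsDeterministic {A B : S} (f : A ⟶ B) : Prop :=
  T.IsTest fun _ : Unit => f

/-- Two events are operationally equivalent (they are the same transformation) if they can be
exchanged in every closed circuit, in the presence of any ancillary system. -/
def OpEquiv {A B : S} (f g : A ⟶ B) : Prop :=
  ∀ (C : S) (Ψ : 𝟙_ S ⟶ A ⊗ C) (a : B ⊗ C ⟶ 𝟙_ S),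
    T.prob (Ψ ≫ f ▷ C ≫ a) = T.prob (Ψ ≫ g ▷ C ≫ a)

/-- A transformation is reversible if it has a two-sided inverse among the transformations. -/
def IsReversible {A B : S} (f : A ⟶ B) : Prop :=
  ∃ g : B ⟶ A, T.OpEquiv (f ≫ g) (𝟙 A) ∧ T.OpEquiv (g ≫ f) (𝟙 B)

/-- The state of a preparation event: the functional that assigns to every observation event its
probability. Two preparation events are the same state iff these functionals agree. -/
def stateVec {A : S} (ρ : 𝟙_ S ⟶ A) : (A ⟶ 𝟙_ S) → ℝ :=
  fun a => T.prob (ρ ≫ a)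

/-- The real vector space spanned by the states of a system. -/
def stateSpace (A : S) : Submodule ℝ ((A ⟶ 𝟙_ S) → ℝ) :=
  Submodule.span ℝ (Set.range (T.stateVec (A := A)))

/-- The size of a system: the dimension of its real vector space of states. -/
def size (A : S) : ℕ :=
  Module.finrank ℝ (T.stateSpace A)

/-- The operational norm, the supremum of `(2 a - e | x)` over all effects `a`, where `e` is the
deterministic effect obtained by coarse-graining an observation test `t` that contains `a`, so that
`(e | x)` is the sum of `(b | x)` over the events `b` of `t`. -/
def opNorm {A : S} (x : (A ⟶ 𝟙_ S) → ℝ) : ℝ :=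
  sSup {r : ℝ | ∃ (X : Type) (_ : Fintype X) (t : X → (A ⟶ 𝟙_ S)) (i : X),
    T.IsTest t ∧ r = 2 * x (t i) - ∑ j, x (t j)}

/-- The events `t i`, `i ∈ Y`, of the preparation test `t` form a refinement of the state `ρ`. -/
def IsRefinement {A : S} (ρ : 𝟙_ S ⟶ A) {X : Type} [Finite X] (t : X → (𝟙_ S ⟶ A))
    (Y : Finset X) : Prop :=
  T.IsTest t ∧ T.stateVec ρ = ∑ i ∈ Y, T.stateVec (t i)

/-- A state is pure if it is atomic: all its refinements are trivial. -/
def IsPure {A : S} (ρ : 𝟙_ S ⟶ A) : Prop :=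
  ∀ (X : Type) [Finite X] (t : X → (𝟙_ S ⟶ A)) (Y : Finset X), T.IsRefinement ρ t Y →
    ∀ i ∈ Y, ∃ c : ℝ, 0 ≤ c ∧ c ≤ 1 ∧ T.stateVec (t i) = c • T.stateVec ρ

/-- `Ψ` is a dilation of `ρ`: some deterministic effect on `C` gives `ρ` back. -/
def IsDilation {A C : S} (ρ : 𝟙_ S ⟶ A) (Ψ : 𝟙_ S ⟶ A ⊗ C) : Prop :=
  ∃ e : C ⟶ 𝟙_ S, T.IsDeterministic e ∧
    T.stateVec ρ = T.stateVec (Ψ ≫ A ◁ e ≫ (ρ_ A).hom)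

/-- A purification is a pure dilation. -/
def IsPurification {A C : S} (ρ : 𝟙_ S ⟶ A) (Ψ : 𝟙_ S ⟶ A ⊗ C) : Prop :=
  T.IsDilation ρ Ψ ∧ T.IsPure Ψ

/-- Parallel composition of two states. -/
def parState {A B : S} (ρ : 𝟙_ S ⟶ A) (σ : 𝟙_ S ⟶ B) : 𝟙_ S ⟶ A ⊗ B :=
  (λ_ (𝟙_ S)).inv ≫ (ρ ⊗ₘ σ)

/-- The composite of `N` copies of a system. -/
def sysPow (A : S) : ℕ → S
  | 0 => 𝟙_ S
  | N + 1 => sysPow A N ⊗ A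

/-- The parallel composition of `N` copies of a state. -/
def statePow {A : S} (ρ : 𝟙_ S ⟶ A) : (N : ℕ) → (𝟙_ S ⟶ sysPow A N)
  | 0 => 𝟙 (𝟙_ S)
  | N + 1 => parState (statePow ρ N) ρ

/-! ### Properties of theories -/

/-- Every system has a finite-dimensional space of states. -/
def FiniteDimensionalStates : Prop :=
  ∀ A : S, FiniteDimensional ℝ (T.stateSpace A)

/-- The set of states of every system is closed. On the finite-dimensional space of states the
topology of pointwise convergence on effects is the Euclidean one. -/
def ClosedStates : Prop :=
  ∀ A : S, IsClosed (Set.range (T.stateVec (A := A)))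

/-- Strong causality: the choice of a test may depend on the outcome of a preceding test. -/
def StronglyCausal : Prop :=
  ∀ {A B C : S} {X : Type} [Finite X] {Y : X → Type} [∀ x, Finite (Y x)]
    (t : X → (A ⟶ B)) (s : (x : X) → Y x → (B ⟶ C)),
    T.IsTest t → (∀ x, T.IsTest (s x)) →
      T.IsTest fun p : (x : X) × Y x => t p.1 ≫ s p.1 p.2

/-- Regular scaling: the size of `N` copies of a system grows at most exponentially. -/
def RegularScaling : Prop :=
  ∀ A : S, ∃ k : ℝ, 0 < k ∧ ∀ N : ℕ, (T.size (sysPow A N) : ℝ) ≤ k * (T.size A : ℝ) ^ N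

/-- `B` is an obit: every system can be encoded without error into finitely many copies of `B`. -/
def IsObit (B : S) : Prop :=
  ∀ A : S, ∃ (k : ℕ) (E : A ⟶ sysPow B k) (D : sysPow B k ⟶ A),
    T.IsDeterministic E ∧ T.IsDeterministic D ∧ T.OpEquiv (E ≫ D) (𝟙 A)

/-- Essential uniqueness of purification: two purifications of the same state with the same
purifying system differ by a reversible transformation of the purifying system. -/
def EssentiallyUniquePurification : Prop :=
  ∀ {A C : S} (ρ : 𝟙_ S ⟶ A) (Φ Ψ : 𝟙_ S ⟶ A ⊗ C), T.IsPurification ρ Φ → T.IsPurification ρ Ψ →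
    ∃ U : C ⟶ C, T.IsReversible U ∧ T.stateVec Ψ = T.stateVec (Φ ≫ A ◁ U)

/-- Atomicity of parallel composition of states. -/
def AtomicParallelComposition : Prop :=
  ∀ {A B : S} (φ : 𝟙_ S ⟶ A) (ψ : 𝟙_ S ⟶ B), T.IsPure φ → T.IsPure ψ → T.IsPure (parState φ ψ)

/-! ### Information content -/

/-- The worst error of the compression scheme `(E, D)` for `N` copies of `ρ`: the supremum, over all
ancillary systems `C` and all refinements of all dilations of the `N` copies, of the total
operational distance between the input and the output of the scheme. -/
def schemeError {A B : S} {N M : ℕ} (ρ : 𝟙_ S ⟶ A) (E : sysPow A N ⟶ sysPow B M)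
    (D : sysPow B M ⟶ sysPow A N) : EReal :=
  sSup {r : EReal | ∃ (C : S) (Ω : 𝟙_ S ⟶ sysPow A N ⊗ C) (X : Type) (_ : Finite X)
    (t : X → (𝟙_ S ⟶ sysPow A N ⊗ C)) (Y : Finset X),
      T.IsDilation (statePow ρ N) Ω ∧ T.IsRefinement Ω t Y ∧
        r = ((∑ i ∈ Y, T.opNorm (T.stateVec (t i ≫ (E ≫ D) ▷ C) - T.stateVec (t i)) : ℝ) : EReal)}

/-- The `ε`-reliable compression schemes from `N` copies of `A` to `M` copies of `B`. -/
def reliableSchemes {A : S} (B : S) (ρ : 𝟙_ S ⟶ A) (N M : ℕ) (ε : ℝ) :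
    Set ((sysPow A N ⟶ sysPow B M) × (sysPow B M ⟶ sysPow A N)) :=
  {p | T.IsDeterministic p.1 ∧ T.IsDeterministic p.2 ∧ T.schemeError ρ p.1 p.2 < (ε : EReal)}

/-- The smallest achievable compression ratio for length `N` to tolerance `ε`, with obit `B`
(infinite if there is no reliable scheme). -/
def compressionRatio {A : S} (B : S) (ρ : 𝟙_ S ⟶ A) (N : ℕ) (ε : ℝ) : ℝ≥0∞ :=
  (⨅ M ∈ {M : ℕ | 0 < M ∧ (T.reliableSchemes B ρ N M ε).Nonempty}, (M : ℝ≥0∞)) / (N : ℝ≥0∞)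

/-- The asymptotic compression ratio to tolerance `ε`. -/
def asymptoticRatio {A : S} (B : S) (ρ : 𝟙_ S ⟶ A) (ε : ℝ) : ℝ≥0∞ :=
  limsup (fun N : ℕ => T.compressionRatio B ρ N ε) atTop

/-- The information content of the state `ρ`, measured in obits `B`. -/
def infoContent {A : S} (B : S) (ρ : 𝟙_ S ⟶ A) : ℝ≥0∞ :=
  limUnder (𝓝[>] (0 : ℝ)) fun ε => T.asymptoticRatio B ρ ε

theorem asymptoticRatio_antitone {A : S} (B : S) (ρ : 𝟙_ S ⟶ A) :
    Antitone (T.asymptoticRatio B ρ) := by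
  intro ε ε' h
  refine limsup_le_limsup (Eventually.of_forall fun N => ?_)
  refine ENNReal.div_le_div_right (biInf_mono ?_) _
  rintro M ⟨hM, p, hE, hD, hp⟩
  exact ⟨hM, p, hE, hD, hp.trans_le (EReal.coe_le_coe_iff.2 h)⟩

/-- The limit that defines the information content always exists. -/
theorem tendsto_infoContent {A : S} (B : S) (ρ : 𝟙_ S ⟶ A) :
    Tendsto (T.asymptoticRatio B ρ) (𝓝[>] (0 : ℝ)) (𝓝 (T.infoContent B ρ)) := by
  have h := (T.asymptoticRatio_antitone B ρ).tendsto_nhdsGT (0 : ℝ)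
  have h2 : T.infoContent B ρ = _ := h.limUnder_eq
  rw [h2]
  exact h

end OPT

end

/-! Direct part. Discard the N copies and prepare them afresh: this map fixes the state `statePow φ
N`, which is pure by atomicity, and one obit suffices for any N. The point is that a local map
fixing a pure state also fixes each of its dilations (`StronglyCausal.stateVec_dilation_comp`). If η
is a pure state of the ancilla, the product of the pure state with η is a purification, so by
essential uniqueness every pure dilation is a product and is fixed. The normalized states with the
given marginal form a compact set, stable under refinement because the marginal is pure, so a linear
functional attains its maximum over the set at a pure state
(`StronglyCausal.exists_isPure_isMaxOn`). Applied to the change of a probability under the map, and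
to its negative, this shows that no dilation changes. Refinements of dilations are rescaled
dilations, so the scheme has error zero.

Converse. If the product of φ and ψ has a nontrivial refinement, then for some observation test the
joint law J of refinement outcome and observed outcome is not the product of its marginals, so its
Bhattacharyya coefficient against that product is less than 1. The coefficient is multiplicative, so
over N runs the correlations become exponentially easy to tell from independence
(`marginalFidelity_prod`, `exists_test_statePow`). But each factor passes, with small error, through
few obits. Correlations carried by a system of size d exceed the product of their marginals by a
factor d at most, in the sense of a guessing game (`sum_filter_le_finrank_mul`, by a barycentric
spanner). Zero information content and regular scaling make d grow at an arbitrarily small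
exponential rate, a contradiction (`StronglyCausal.one_lt_of_reliableSchemes`,
`StronglyCausal.isPure_parState`). Existence of normalized versions of states, from closedness
(`StronglyCausal.exists_normalized`), reduces atomicity to deterministic states. -/

namespace OPT

/-! ### Parallel composition of states in a monoidal category -/

section Monoidal

variable {S : Type u} [Category.{v} S] [MonoidalCategory S]

theorem parState_eq_left {A B : S} (ρ : 𝟙_ S ⟶ A) (σ : 𝟙_ S ⟶ B) :
    parState ρ σ = ρ ≫ (ρ_ A).inv ≫ A ◁ σ := by
  simp [parState, MonoidalCategory.tensorHom_def, unitors_inv_equal]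

theorem parState_eq_right {A B : S} (ρ : 𝟙_ S ⟶ A) (σ : 𝟙_ S ⟶ B) :
    parState ρ σ = σ ≫ (λ_ B).inv ≫ ρ ▷ B := by
  simp [parState, tensorHom_def']

theorem parState_tensor {A B A' B' : S} (ρ : 𝟙_ S ⟶ A) (σ : 𝟙_ S ⟶ B) (f : A ⟶ A') (g : B ⟶ B') :
    parState ρ σ ≫ (f ⊗ₘ g) = parState (ρ ≫ f) (σ ≫ g) := by
  simp [parState]

theorem parState_whiskerRight {A B A' : S} (ρ : 𝟙_ S ⟶ A) (σ : 𝟙_ S ⟶ B) (f : A ⟶ A') :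
    parState ρ σ ≫ f ▷ B = parState (ρ ≫ f) σ := by
  rw [← tensorHom_id, parState_tensor, Category.comp_id]

theorem parState_whiskerLeft {A B B' : S} (ρ : 𝟙_ S ⟶ A) (σ : 𝟙_ S ⟶ B) (f : B ⟶ B') :
    parState ρ σ ≫ A ◁ f = parState ρ (σ ≫ f) := by
  rw [← id_tensorHom, parState_tensor, Category.comp_id]

theorem parState_scalar_right {A : S} (ρ : 𝟙_ S ⟶ A) (s : 𝟙_ S ⟶ 𝟙_ S) :
    parState ρ s ≫ (ρ_ A).hom = s ≫ ρ := by
  simp [parState_eq_right, unitors_inv_equal]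

theorem parState_scalar_left {A : S} (ρ : 𝟙_ S ⟶ A) (s : 𝟙_ S ⟶ 𝟙_ S) :
    parState s ρ ≫ (λ_ A).hom = s ≫ ρ := by
  simp [parState_eq_left, unitors_equal]

end Monoidal

variable {S : Type u} [Category.{v} S] [MonoidalCategory S] [SymmetricCategory S] {T : OPT S}

/-! ### Tests and deterministic events -/

theorem IsDeterministic.comp {A B C : S} {f : A ⟶ B} {g : B ⟶ C} (hf : T.IsDeterministic f)
    (hg : T.IsDeterministic g) : T.IsDeterministic (f ≫ g) :=
  T.test_relabel (fun _ : Unit × Unit => f ≫ g) (Equiv.prodPUnit Unit).symm (T.test_comp _ _ hf hg)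

theorem IsDeterministic.tensor {A B C D : S} {f : A ⟶ B} {g : C ⟶ D} (hf : T.IsDeterministic f)
    (hg : T.IsDeterministic g) : T.IsDeterministic (f ⊗ₘ g) :=
  T.test_relabel (fun _ : Unit × Unit => f ⊗ₘ g) (Equiv.prodPUnit Unit).symm
    (T.test_tensor _ _ hf hg)

theorem IsDeterministic.whiskerRight {A B : S} {f : A ⟶ B} (hf : T.IsDeterministic f) (C : S) :
    T.IsDeterministic (f ▷ C) := by
  rw [← tensorHom_id]; exact hf.tensor (T.test_id C)

theorem IsDeterministic.whiskerLeft {A B : S} {f : A ⟶ B} (hf : T.IsDeterministic f) (C : S) :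
    T.IsDeterministic (C ◁ f) := by
  rw [← id_tensorHom]; exact IsDeterministic.tensor (T.test_id C) hf

theorem IsTest.comp_deterministic {A B C : S} {X : Type} [Finite X] {t : X → (A ⟶ B)} {g : B ⟶ C}
    (ht : T.IsTest t) (hg : T.IsDeterministic g) : T.IsTest fun x => t x ≫ g :=
  T.test_relabel (fun p : X × Unit => t p.1 ≫ g) (Equiv.prodPUnit X).symm (T.test_comp _ _ ht hg)

theorem IsDeterministic.comp_test {A B C : S} {X : Type} [Finite X] {f : A ⟶ B} {t : X → (B ⟶ C)}
    (hf : T.IsDeterministic f) (ht : T.IsTest t) : T.IsTest fun x => f ≫ t x :=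
  T.test_relabel (fun p : Unit × X => f ≫ t p.2) (Equiv.punitProd X).symm (T.test_comp _ _ hf ht)

theorem isDeterministic_braiding_inv (A B : S) : T.IsDeterministic (β_ A B).inv := by
  rw [← SymmetricCategory.braiding_swap_eq_inv_braiding]; exact T.test_braiding B A

theorem isDeterministic_tensorμ (A B C D : S) : T.IsDeterministic (tensorμ A B C D) := by
  unfold tensorμ
  refine .comp (T.test_associator_hom _ _ _) (.comp (.whiskerLeft (T.test_associator_inv _ _ _) _)
    (.comp (.whiskerLeft (.whiskerRight (T.test_braiding _ _) _) _)
      (.comp (.whiskerLeft (T.test_associator_hom _ _ _) _) (T.test_associator_inv _ _ _))))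

theorem isDeterministic_tensorδ (A B C D : S) : T.IsDeterministic (tensorδ A B C D) := by
  unfold tensorδ
  refine .comp (T.test_associator_hom _ _ _) (.comp (.whiskerLeft (T.test_associator_inv _ _ _) _)
    (.comp (.whiskerLeft (.whiskerRight (isDeterministic_braiding_inv _ _) _) _)
      (.comp (.whiskerLeft (T.test_associator_hom _ _ _) _) (T.test_associator_inv _ _ _))))

theorem prob_of_isDeterministic {s : 𝟙_ S ⟶ 𝟙_ S} (hs : T.IsDeterministic s) : T.prob s = 1 := by
  simpa using T.sum_prob _ hs

theorem prob_le_one (s : 𝟙_ S ⟶ 𝟙_ S) : T.prob s ≤ 1 := by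
  obtain ⟨X, _, t, x, ht, rfl⟩ := T.event_mem_test s
  have := Fintype.ofFinite X
  rw [← T.sum_prob t ht]
  exact Finset.single_le_sum (fun i _ => T.prob_nonneg _) (Finset.mem_univ x)

/-- Between a preparation test and an observation test, an empty test would give an empty
probability distribution, of total 0 instead of 1. -/
theorem IsTest.nonempty {A B : S} {X : Type} [Finite X] {t : X → (A ⟶ B)} (ht : T.IsTest t) :
    Nonempty X := by
  by_contra h
  rw [not_nonempty_iff] at h
  obtain ⟨a⟩ := T.nonempty_observation B
  obtain ⟨Z, _, s, -, hs, -⟩ := T.event_mem_test a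
  obtain ⟨p⟩ := T.nonempty_preparation A
  obtain ⟨W, _, r, -, hr, -⟩ := T.event_mem_test p
  have := Fintype.ofFinite W
  have := Fintype.ofFinite Z
  have := Fintype.ofFinite X
  have := T.sum_prob _ (T.test_comp _ _ (T.test_comp _ _ hr ht) hs)
  simp at this

theorem coarse_grain_circuit {A B : S} {X Y : Type} [Fintype X] [Finite Y] [DecidableEq Y]
    {t : X → (A ⟶ B)} (r : X → Y) (ht : T.IsTest t) (hr : Function.Surjective r) :
    ∃ s : Y → (A ⟶ B), T.IsTest s ∧ ∀ (y : Y) (ψ : 𝟙_ S ⟶ A) (a : B ⟶ 𝟙_ S),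
      T.prob (ψ ≫ s y ≫ a) = ∑ x with r x = y, T.prob (ψ ≫ t x ≫ a) := by
  obtain ⟨s, hs, h⟩ := T.coarse_grain t r ht hr
  refine ⟨s, hs, fun y ψ a => ?_⟩
  have := h y (𝟙_ S) (ψ ≫ (ρ_ A).inv) ((ρ_ B).hom ≫ a)
  simpa [rightUnitor_naturality_assoc] using this

/-- Merging all the outcomes of a test gives a deterministic event. -/
theorem IsTest.exists_isDeterministic {A B : S} {X : Type} [Fintype X] {t : X → (A ⟶ B)}
    (ht : T.IsTest t) : ∃ f : A ⟶ B, T.IsDeterministic f ∧ ∀ (ψ : 𝟙_ S ⟶ A) (a : B ⟶ 𝟙_ S),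
      T.prob (ψ ≫ f ≫ a) = ∑ x, T.prob (ψ ≫ t x ≫ a) := by
  obtain ⟨x⟩ := ht.nonempty
  obtain ⟨s, hs, h⟩ := coarse_grain_circuit (fun _ => ()) ht (fun _ => ⟨x, rfl⟩)
  exact ⟨s (), hs, fun ψ a => by simpa using h () ψ a⟩

/-- Merging some of the outcomes of a test gives an event. -/
theorem IsTest.exists_sum {A B : S} {X : Type} [Fintype X] {t : X → (A ⟶ B)}
    (ht : T.IsTest t) {Y : Finset X} (hY : Y.Nonempty) :
    ∃ f : A ⟶ B, ∀ (ψ : 𝟙_ S ⟶ A) (a : B ⟶ 𝟙_ S),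
      T.prob (ψ ≫ f ≫ a) = ∑ x ∈ Y, T.prob (ψ ≫ t x ≫ a) := by
  classical
  obtain ⟨x, hx⟩ := hY
  -- Coarse-graining needs a surjective outcome map, so the indicator of `Y` is corestricted to its
  -- range; this also covers `Y` being everything.
  let r : X → Set.range (fun x => decide (x ∈ Y)) := Set.rangeFactorization _
  obtain ⟨s, -, h⟩ := coarse_grain_circuit r ht Set.rangeFactorization_surjective
  refine ⟨s (r x), fun ψ a => ?_⟩
  rw [h]
  refine Finset.sum_congr ?_ fun _ _ => rfl
  ext y
  simp [r, Set.rangeFactorization, Subtype.ext_iff, hx]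

theorem exists_isDeterministic_state (T : OPT S) (A : S) :
    ∃ ρ : 𝟙_ S ⟶ A, T.IsDeterministic ρ := by
  obtain ⟨p⟩ := T.nonempty_preparation A
  obtain ⟨W, _, r, -, hr, -⟩ := T.event_mem_test p
  have := Fintype.ofFinite W
  exact hr.exists_isDeterministic.imp fun _ h => h.1

theorem exists_isDeterministic_effect (T : OPT S) (A : S) :
    ∃ e : A ⟶ 𝟙_ S, T.IsDeterministic e := by
  obtain ⟨p⟩ := T.nonempty_observation A
  obtain ⟨W, _, r, -, hr, -⟩ := T.event_mem_test p
  have := Fintype.ofFinite W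
  exact hr.exists_isDeterministic.imp fun _ h => h.1

/-- The deterministic effect of a system. -/
noncomputable def discard (T : OPT S) (A : S) : A ⟶ 𝟙_ S :=
  (T.exists_isDeterministic_effect A).choose

theorem isDeterministic_discard (T : OPT S) (A : S) : T.IsDeterministic (T.discard A) :=
  (T.exists_isDeterministic_effect A).choose_spec

/-! ### Causality -/

theorem StronglyCausal.conditional (hT : T.StronglyCausal) {A B C : S} {X : Type} [Finite X]
    {t : X → (A ⟶ B)} (s : X → (B ⟶ C)) (ht : T.IsTest t) (hs : ∀ x, T.IsDeterministic (s x)) :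
    T.IsTest fun x => t x ≫ s x :=
  T.test_relabel (fun p : (_ : X) × Unit => t p.1 ≫ s p.1)
    ⟨fun x => ⟨x, ()⟩, fun p => p.1, fun _ => rfl, fun _ => rfl⟩
    (hT (Y := fun _ => Unit) t (fun x _ => s x) ht hs)

/-- No signalling from the future: use `e` after the outcome giving `ψ` and `discard` after all the
others. The total probability is 1 for either choice at that one outcome, so the two contributions
agree. -/
theorem StronglyCausal.prob_deterministic_effect (hT : T.StronglyCausal) {A : S} (ψ : 𝟙_ S ⟶ A)
    {e : A ⟶ 𝟙_ S} (he : T.IsDeterministic e) : T.prob (ψ ≫ e) = T.prob (ψ ≫ T.discard A) := by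
  classical
  obtain ⟨X, _, t, x, ht, rfl⟩ := T.event_mem_test ψ
  have := Fintype.ofFinite X
  have h1 := T.sum_prob _ (hT.conditional (fun y => if y = x then e else T.discard A) ht
    (fun y => by split_ifs; exacts [he, T.isDeterministic_discard A]))
  have h2 := T.sum_prob _ (ht.comp_deterministic (T.isDeterministic_discard A))
  rw [← h1, ← Finset.add_sum_erase _ _ (Finset.mem_univ x),
    ← Finset.add_sum_erase _ _ (Finset.mem_univ x)] at h2
  have h3 : ∑ y ∈ Finset.univ.erase x, T.prob (t y ≫ if y = x then e else T.discard A) =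
      ∑ y ∈ Finset.univ.erase x, T.prob (t y ≫ T.discard A) :=
    Finset.sum_congr rfl fun y hy => by rw [if_neg (Finset.ne_of_mem_erase hy)]
  rw [if_pos rfl, h3] at h2
  linarith

theorem StronglyCausal.sum_prob_effect (hT : T.StronglyCausal) {A : S} (ψ : 𝟙_ S ⟶ A) {X : Type}
    [Fintype X] {t : X → (A ⟶ 𝟙_ S)} (ht : T.IsTest t) :
    ∑ x, T.prob (ψ ≫ t x) = T.prob (ψ ≫ T.discard A) := by
  obtain ⟨f, hf, h⟩ := ht.exists_isDeterministic
  rw [← hT.prob_deterministic_effect ψ hf]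
  simpa using (h ψ (𝟙 _)).symm

theorem StronglyCausal.prob_effect_le (hT : T.StronglyCausal) {A : S} (ψ : 𝟙_ S ⟶ A)
    (a : A ⟶ 𝟙_ S) : T.prob (ψ ≫ a) ≤ T.prob (ψ ≫ T.discard A) := by
  obtain ⟨X, _, t, x, ht, rfl⟩ := T.event_mem_test a
  have := Fintype.ofFinite X
  rw [← hT.sum_prob_effect ψ ht]
  exact Finset.single_le_sum (f := fun x => T.prob (ψ ≫ t x)) (fun i _ => T.prob_nonneg _)
    (Finset.mem_univ x)

theorem StronglyCausal.stateVec_eq_zero (hT : T.StronglyCausal) {A : S} {ψ : 𝟙_ S ⟶ A}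
    (h : T.prob (ψ ≫ T.discard A) = 0) : T.stateVec ψ = 0 := by
  funext a
  exact le_antisymm ((hT.prob_effect_le ψ a).trans h.le) (T.prob_nonneg _)

theorem StronglyCausal.prob_deterministic_comp (hT : T.StronglyCausal) {A B : S} (ψ : 𝟙_ S ⟶ A)
    {f : A ⟶ B} (hf : T.IsDeterministic f) :
    T.prob (ψ ≫ f ≫ T.discard B) = T.prob (ψ ≫ T.discard A) :=
  hT.prob_deterministic_effect ψ (hf.comp (T.isDeterministic_discard B))

/-! ### States as functionals -/

theorem stateVec_comp {A B : S} {ψ χ : 𝟙_ S ⟶ A} (h : T.stateVec ψ = T.stateVec χ)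
    (f : A ⟶ B) : T.stateVec (ψ ≫ f) = T.stateVec (χ ≫ f) := by
  funext a
  simpa [stateVec] using congrFun h (f ≫ a)

theorem stateVec_comp_sum {A B : S} {X : Type} {ψ : 𝟙_ S ⟶ A} {t : X → (𝟙_ S ⟶ A)} {Y : Finset X}
    (h : T.stateVec ψ = ∑ i ∈ Y, T.stateVec (t i)) (f : A ⟶ B) :
    T.stateVec (ψ ≫ f) = ∑ i ∈ Y, T.stateVec (t i ≫ f) := by
  funext a
  simpa [stateVec] using congrFun h (f ≫ a)

theorem stateVec_comp_smul {A B : S} {ψ χ : 𝟙_ S ⟶ A} {c : ℝ}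
    (h : T.stateVec ψ = c • T.stateVec χ) (f : A ⟶ B) :
    T.stateVec (ψ ≫ f) = c • T.stateVec (χ ≫ f) := by
  funext a
  simpa [stateVec] using congrFun h (f ≫ a)

theorem stateVec_scalar_comp {A : S} (s : 𝟙_ S ⟶ 𝟙_ S) (ψ : 𝟙_ S ⟶ A) :
    T.stateVec (s ≫ ψ) = T.prob s • T.stateVec ψ := by
  funext a
  simp [stateVec, T.prob_comp]

theorem IsRefinement.comp {A B : S} {ρ : 𝟙_ S ⟶ A} {X : Type} [Finite X] {t : X → (𝟙_ S ⟶ A)}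
    {Y : Finset X} (h : T.IsRefinement ρ t Y) {f : A ⟶ B} (hf : T.IsDeterministic f) :
    T.IsRefinement (ρ ≫ f) (fun i => t i ≫ f) Y :=
  ⟨h.1.comp_deterministic hf, stateVec_comp_sum h.2 f⟩

theorem IsDeterministic.parallel {A B : S} {ρ : 𝟙_ S ⟶ A} {σ : 𝟙_ S ⟶ B}
    (hρ : T.IsDeterministic ρ) (hσ : T.IsDeterministic σ) : T.IsDeterministic (parState ρ σ) :=
  IsDeterministic.comp (T.test_leftUnitor_inv _) (hρ.tensor hσ)

theorem IsDeterministic.statePow {A : S} {ρ : 𝟙_ S ⟶ A} (hρ : T.IsDeterministic ρ) :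
    ∀ N, T.IsDeterministic (statePow ρ N)
  | 0 => T.test_id _
  | N + 1 => (IsDeterministic.statePow hρ N).parallel hρ

theorem parState_discard_right {A B : S} (ρ : 𝟙_ S ⟶ A) (σ : 𝟙_ S ⟶ B) (e : B ⟶ 𝟙_ S) :
    T.stateVec (parState ρ σ ≫ A ◁ e ≫ (ρ_ A).hom) = T.prob (σ ≫ e) • T.stateVec ρ := by
  rw [← Category.assoc, parState_whiskerLeft, parState_scalar_right, stateVec_scalar_comp]

theorem IsDeterministic.prob_discard {A : S} {ρ : 𝟙_ S ⟶ A} (hρ : T.IsDeterministic ρ) :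
    T.prob (ρ ≫ T.discard A) = 1 :=
  prob_of_isDeterministic (hρ.comp (T.isDeterministic_discard A))

theorem IsDeterministic.isDilation_parState {A B : S} (ρ : 𝟙_ S ⟶ A) {σ : 𝟙_ S ⟶ B}
    (hσ : T.IsDeterministic σ) : T.IsDilation ρ (parState ρ σ) :=
  ⟨T.discard B, T.isDeterministic_discard B, by
    rw [parState_discard_right, hσ.prob_discard, one_smul]⟩

theorem parState_stateVec_left_smul {A B : S} {ρ ρ' : 𝟙_ S ⟶ A} {c : ℝ}
    (h : T.stateVec ρ = c • T.stateVec ρ') (σ : 𝟙_ S ⟶ B) :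
    T.stateVec (parState ρ σ) = c • T.stateVec (parState ρ' σ) := by
  rw [parState_eq_left, parState_eq_left]
  exact stateVec_comp_smul h _

theorem parState_stateVec_right_smul {A B : S} (ρ : 𝟙_ S ⟶ A) {σ σ' : 𝟙_ S ⟶ B} {c : ℝ}
    (h : T.stateVec σ = c • T.stateVec σ') :
    T.stateVec (parState ρ σ) = c • T.stateVec (parState ρ σ') := by
  rw [parState_eq_right, parState_eq_right]
  exact stateVec_comp_smul h _

/-! ### Normalization of states -/

theorem IsTest.exists_sum_state {A : S} {X : Type} [Fintype X] {t : X → (𝟙_ S ⟶ A)}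
    (ht : T.IsTest t) {Y : Finset X} (hY : Y.Nonempty) :
    ∃ ρ : 𝟙_ S ⟶ A, T.stateVec ρ = ∑ x ∈ Y, T.stateVec (t x) := by
  obtain ⟨ρ, hρ⟩ := ht.exists_sum hY
  refine ⟨ρ, ?_⟩
  funext a
  simpa [stateVec] using hρ (𝟙 _) a

theorem IsTest.exists_isDeterministic_state {A : S} {X : Type} [Fintype X]
    {t : X → (𝟙_ S ⟶ A)} (ht : T.IsTest t) :
    ∃ ρ : 𝟙_ S ⟶ A, T.IsDeterministic ρ ∧ T.stateVec ρ = ∑ x, T.stateVec (t x) := by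
  obtain ⟨ρ, hρ, h⟩ := ht.exists_isDeterministic
  refine ⟨ρ, hρ, ?_⟩
  funext a
  simpa [stateVec] using h (𝟙 _) a

theorem IsTest.sum_prob_discard {A : S} {X : Type} [Fintype X] {t : X → (𝟙_ S ⟶ A)}
    (ht : T.IsTest t) : ∑ x, T.prob (t x ≫ T.discard A) = 1 :=
  T.sum_prob _ (ht.comp_deterministic (T.isDeterministic_discard A))

/-- The outcomes outside a refinement of a normalized state have probability zero. -/
theorem StronglyCausal.stateVec_eq_zero_of_notMem (hT : T.StronglyCausal) {A : S} {X : Type}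
    [Fintype X] {t : X → (𝟙_ S ⟶ A)} (ht : T.IsTest t) {Y : Finset X}
    (hY : ∑ x ∈ Y, T.prob (t x ≫ T.discard A) = 1) {x : X} (hx : x ∉ Y) :
    T.stateVec (t x) = 0 := by
  classical
  apply hT.stateVec_eq_zero
  have h := ht.sum_prob_discard
  rw [← Finset.sum_add_sum_compl Y, hY] at h
  have h0 : ∑ x ∈ Yᶜ, T.prob (t x ≫ T.discard A) = 0 := by linarith
  exact (Finset.sum_eq_zero_iff_of_nonneg fun i _ => T.prob_nonneg _).1 h0 x (by simpa using hx)

/-- All other outcomes of a test containing `ψ` have probability zero, so merging the whole test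
changes nothing. -/
theorem StronglyCausal.exists_isDeterministic_of_prob_eq_one (hT : T.StronglyCausal) {A : S}
    {ψ : 𝟙_ S ⟶ A} (h : T.prob (ψ ≫ T.discard A) = 1) :
    ∃ χ : 𝟙_ S ⟶ A, T.IsDeterministic χ ∧ T.stateVec χ = T.stateVec ψ := by
  obtain ⟨X, _, t, x, ht, rfl⟩ := T.event_mem_test ψ
  have := Fintype.ofFinite X
  obtain ⟨χ, hχ, hs⟩ := ht.exists_isDeterministic_state
  refine ⟨χ, hχ, hs.trans (Finset.sum_eq_single x (fun y _ hy => ?_) (by simp))⟩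
  exact hT.stateVec_eq_zero_of_notMem ht (Y := {x}) (by simpa using h) (by simpa using hy)

/-- Preparing `ψ` and, if that fails, `χ`. -/
theorem StronglyCausal.exists_retry (hT : T.StronglyCausal) {A : S} (ψ χ : 𝟙_ S ⟶ A) :
    ∃ ω : 𝟙_ S ⟶ A, T.stateVec ω =
      T.stateVec ψ + (1 - T.prob (ψ ≫ T.discard A)) • T.stateVec χ := by
  classical
  obtain ⟨X, _, t, x, ht, rfl⟩ := T.event_mem_test ψ
  obtain ⟨U, _, u, j, hu, rfl⟩ := T.event_mem_test χ
  have := Fintype.ofFinite X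
  have := Fintype.ofFinite U
  have e := T.isDeterministic_discard A
  have h1 : T.IsTest fun p : X × U => parState (t p.1) (u p.2) :=
    IsDeterministic.comp_test (T.test_leftUnitor_inv _) (T.test_tensor _ _ ht hu)
  -- Both preparations are run in parallel, and the outcome of the first decides which of the two
  -- systems is discarded.
  have h2 := hT.conditional (fun p : X × U => if p.1 = x then A ◁ T.discard A ≫ (ρ_ A).hom else
    T.discard A ▷ A ≫ (λ_ A).hom) h1 (fun p => by
      split_ifs
      exacts [(e.whiskerLeft A).comp (T.test_rightUnitor_hom A),
        (e.whiskerRight A).comp (T.test_leftUnitor_hom A)])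
  obtain ⟨ω, hω⟩ := h2.exists_sum_state (Y := {p | p.1 = x ∨ p.2 = j}) ⟨(x, j), by simp⟩
  refine ⟨ω, hω.trans ?_⟩
  rw [Finset.sum_filter, Fintype.sum_prod_type, ← Finset.add_sum_erase _ _ (Finset.mem_univ x)]
  have hsum := ht.sum_prob_discard
  rw [← Finset.add_sum_erase _ _ (Finset.mem_univ x)] at hsum
  congr 1
  · simp [parState_discard_right, ← Finset.sum_smul, hu.sum_prob_discard]
  · rw [← hsum, add_sub_cancel_left, Finset.sum_smul]
    refine Finset.sum_congr rfl fun y hy => ?_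
    simp only [Finset.ne_of_mem_erase hy, false_or, if_false, Finset.sum_ite_eq', Finset.mem_univ,
      if_true]
    rw [← Category.assoc, parState_whiskerRight, parState_scalar_left, stateVec_scalar_comp]

/-- Every nonzero state is a multiple of a normalized state. -/
theorem StronglyCausal.exists_normalized (hT : T.StronglyCausal) (hcl : T.ClosedStates) {A : S}
    {ψ : 𝟙_ S ⟶ A} (h : 0 < T.prob (ψ ≫ T.discard A)) :
    ∃ χ : 𝟙_ S ⟶ A, T.IsDeterministic χ ∧
      T.stateVec χ = (T.prob (ψ ≫ T.discard A))⁻¹ • T.stateVec ψ := by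
  set l := T.prob (ψ ≫ T.discard A) with hl
  have hl1 : l ≤ 1 := T.prob_le_one _
  let R : Set ℝ := (fun c : ℝ => c • T.stateVec ψ) ⁻¹' Set.range (T.stateVec (A := A))
  have hR : IsClosed R := (hcl A).preimage (by fun_prop)
  have hle : ∀ c ∈ R, c * l ≤ 1 := by
    rintro c ⟨χ, hχ⟩
    have := congrFun hχ (T.discard A)
    simp only [stateVec, Pi.smul_apply, smul_eq_mul] at this
    rw [hl, ← this]
    exact T.prob_le_one _
  have hc : IsCompact (R ∩ Set.Icc 1 l⁻¹) := isCompact_Icc.inter_left hR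
  have h1 : (1 : ℝ) ∈ R ∩ Set.Icc 1 l⁻¹ :=
    ⟨⟨ψ, by simp⟩, le_rfl, (one_le_inv₀ h).2 hl1⟩
  obtain ⟨c, ⟨⟨χ, hχ⟩, hc1, hc2⟩, hmax⟩ := hc.exists_isMaxOn ⟨1, h1⟩ continuousOn_id
  -- For the largest admissible factor `c`, retrying with `χ` after `ψ` gives the admissible factor
  -- `1 + (1 - l) * c`. Maximality bounds it by `c`, which forces `c * l ≥ 1`.
  have hcl1 : c = l⁻¹ := by
    obtain ⟨ω, hω⟩ := hT.exists_retry ψ χ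
    have hmem : 1 + (1 - l) * c ∈ R := ⟨ω, by
      simp only [hω, hχ, smul_smul, add_smul, one_smul, hl]⟩
    have hb := hle _ hmem
    have hm : 1 + (1 - l) * c ≤ c := hmax ⟨hmem, by
      nlinarith, by rw [← one_div, le_div_iff₀ h]; exact hb⟩
    refine le_antisymm hc2 ?_
    rw [← one_div, div_le_iff₀ h]
    nlinarith
  subst hcl1
  have hp : T.prob (χ ≫ T.discard A) = 1 := by
    have := congrFun hχ (T.discard A)
    simp only [stateVec, Pi.smul_apply, smul_eq_mul] at this
    rw [this, ← hl, inv_mul_cancel₀ h.ne']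
  obtain ⟨χ', hχ', he⟩ := hT.exists_isDeterministic_of_prob_eq_one hp
  exact ⟨χ', hχ', he.trans hχ⟩

/-! ### Existence of pure states -/

theorem IsPure.congr {A : S} {ρ σ : 𝟙_ S ⟶ A} (hρ : T.IsPure ρ)
    (h : T.stateVec σ = T.stateVec ρ) : T.IsPure σ := by
  intro X _ t Y ht i hi
  rw [h]
  exact hρ X t Y ⟨ht.1, h ▸ ht.2⟩ i hi

theorem IsRefinement.sum_prob {A : S} {ρ : 𝟙_ S ⟶ A} {X : Type} [Finite X]
    {t : X → (𝟙_ S ⟶ A)} {Y : Finset X} (h : T.IsRefinement ρ t Y) (a : A ⟶ 𝟙_ S) :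
    ∑ i ∈ Y, T.prob (t i ≫ a) = T.prob (ρ ≫ a) := by
  simpa [stateVec] using (congrFun h.2 a).symm

theorem IsPure.stateVec_eq {A : S} {ρ : 𝟙_ S ⟶ A} (hρ : T.IsPure ρ) (hdet : T.IsDeterministic ρ)
    {X : Type} [Finite X] {t : X → (𝟙_ S ⟶ A)} {Y : Finset X} (h : T.IsRefinement ρ t Y) {i : X}
    (hi : i ∈ Y) : T.stateVec (t i) = T.prob (t i ≫ T.discard A) • T.stateVec ρ := by
  obtain ⟨c, -, -, hc⟩ := hρ X t Y h i hi
  have := congrFun hc (T.discard A)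
  simp only [stateVec, Pi.smul_apply, smul_eq_mul, hdet.prob_discard, mul_one] at this
  rw [this]
  exact hc

/-- A linear functional attains its maximum over a closed set of normalized states that is stable
under refinement at a pure state. -/
theorem StronglyCausal.exists_isPure_isMaxOn (hT : T.StronglyCausal)
    (hfin : T.FiniteDimensionalStates) {A : S} {F : Set ((A ⟶ 𝟙_ S) → ℝ)} (hF : IsClosed F)
    (hne : F.Nonempty) (hdet : ∀ x ∈ F, ∃ ρ : 𝟙_ S ⟶ A, T.IsDeterministic ρ ∧ T.stateVec ρ = x)
    (href : ∀ (ρ : 𝟙_ S ⟶ A) (X : Type) [Finite X] (t : X → (𝟙_ S ⟶ A)) (Y : Finset X),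
      T.stateVec ρ ∈ F → T.IsRefinement ρ t Y → ∀ i ∈ Y, 0 < T.prob (t i ≫ T.discard A) →
        (T.prob (t i ≫ T.discard A))⁻¹ • T.stateVec (t i) ∈ F)
    (l : ((A ⟶ 𝟙_ S) → ℝ) →L[ℝ] ℝ) :
    ∃ ρ : 𝟙_ S ⟶ A, T.IsDeterministic ρ ∧ T.IsPure ρ ∧ T.stateVec ρ ∈ F ∧
      ∀ x ∈ F, l x ≤ l (T.stateVec ρ) := by
  have := hfin A
  -- Probabilities lie in [0, 1], so `F` is a closed subset of a Tychonoff cube.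
  have hFc : IsCompact F := by
    refine (isCompact_univ_pi fun _ : (A ⟶ 𝟙_ S) => isCompact_Icc (a := (0 : ℝ)) (b := 1)
      ).of_isClosed_subset hF ?_
    intro x hx a _
    obtain ⟨ρ, -, rfl⟩ := hdet x hx
    exact ⟨T.prob_nonneg _, T.prob_le_one _⟩
  obtain ⟨m, hmF, hm⟩ := hFc.exists_isMaxOn hne l.continuous.continuousOn
  have hFsub : F ⊆ T.stateSpace A := by
    intro x hx
    obtain ⟨ρ, -, rfl⟩ := hdet x hx
    exact Submodule.subset_span ⟨ρ, rfl⟩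
  let F' : Set (T.stateSpace A) := Subtype.val ⁻¹' (F ∩ {x | l x = l m})
  have hF'c : IsCompact F' := by
    have himg : Subtype.val '' F' = F ∩ {x | l x = l m} :=
      Set.image_preimage_eq_of_subset fun x hx => ⟨⟨x, hFsub hx.1⟩, rfl⟩
    have himgc : IsCompact (Subtype.val '' F') := by
      rw [himg]
      exact hFc.inter_right (isClosed_eq l.continuous continuous_const)
    exact Topology.IsInducing.subtypeVal.isCompact_iff.2 himgc
  let L : T.stateSpace A ≃ₗ[ℝ] EuclideanSpace ℝ (Fin (Module.finrank ℝ (T.stateSpace A))) :=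
    LinearEquiv.ofFinrankEq _ _ finrank_euclideanSpace_fin.symm
  have hL : Continuous L := L.toLinearMap.continuous_of_finiteDimensional
  -- Among the maximizers of `l`, one of largest Euclidean norm is taken: strict convexity of the
  -- norm will make it pure.
  obtain ⟨w, ⟨hwF, hwl⟩, hw⟩ := hF'c.exists_isMaxOn ⟨⟨m, hFsub hmF⟩, hmF, rfl⟩
    (hL.norm.continuousOn)
  obtain ⟨ρ, hρ, hρw⟩ := hdet _ hwF
  refine ⟨ρ, hρ, ?_, hρw ▸ hwF, fun x hx => ?_⟩
  swap
  · rw [hρw, hwl]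
    exact hm hx
  intro X _ t Y h i hi
  set μ : X → ℝ := fun i => T.prob (t i ≫ T.discard A) with hμ
  have hμ0 : ∀ i, 0 ≤ μ i := fun i => T.prob_nonneg _
  have hμ1 : ∑ i ∈ Y, μ i = 1 := by
    rw [h.sum_prob, hρ.prob_discard]
  refine ⟨μ i, hμ0 i, T.prob_le_one _, ?_⟩
  have hz : ∀ i, μ i = 0 → T.stateVec (t i) = 0 := fun i hi => hT.stateVec_eq_zero hi
  have hmem : ∀ i ∈ Y, 0 < μ i → (μ i)⁻¹ • T.stateVec (t i) ∈ F := fun i hi hpos =>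
    href ρ X t Y (hρw ▸ hwF) h i hi hpos
  have hsplit : ∀ i ∈ Y, 0 < μ i → T.stateVec (t i) = μ i • ((μ i)⁻¹ • T.stateVec (t i)) :=
    fun i _ hpos => by rw [smul_smul, mul_inv_cancel₀ hpos.ne', one_smul]
  have hlle : ∀ i ∈ Y, l (T.stateVec (t i)) ≤ μ i * l m := by
    intro i hi
    rcases (hμ0 i).eq_or_lt with h0 | hpos
    · rw [hz i h0.symm, ← h0]; simp
    · rw [hsplit i hi hpos, map_smul, smul_eq_mul]
      exact mul_le_mul_of_nonneg_left (hm (hmem i hi hpos)) hpos.le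
  have hleq := (Finset.sum_eq_sum_iff_of_le hlle).1 (by
    rw [← map_sum, ← h.2, ← Finset.sum_mul, hμ1, one_mul, hρw, hwl])
  let v : X → T.stateSpace A := fun i => ⟨T.stateVec (t i), Submodule.subset_span ⟨t i, rfl⟩⟩
  have hsum : ∑ i ∈ Y, L (v i) = L w := by
    rw [← map_sum]
    congr 1
    apply Subtype.ext
    rw [← hρw, h.2, AddSubmonoidClass.coe_finsetSum]
  have hnorm : ∀ i ∈ Y, ‖L (v i)‖ ≤ μ i * ‖L w‖ := by
    intro i hi
    rcases (hμ0 i).eq_or_lt with h0 | hpos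
    · have : v i = 0 := Subtype.ext (hz i h0.symm)
      rw [this, ← h0]; simp
    · have hin : (μ i)⁻¹ • v i ∈ F' := by
        refine ⟨hmem i hi hpos, ?_⟩
        change l ((μ i)⁻¹ • T.stateVec (t i)) = l m
        rw [map_smul, hleq i hi, smul_eq_mul, inv_mul_cancel_left₀ hpos.ne']
      have := hw hin
      simp only [Set.mem_ofPred_eq, map_smul, norm_smul, norm_inv, Real.norm_eq_abs,
        abs_of_pos hpos] at this
      rwa [inv_mul_le_iff₀ hpos] at this
  have hinner : ∀ i ∈ Y, inner ℝ (L (v i)) (L w) ≤ μ i * ‖L w‖ ^ 2 := by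
    intro i hi
    refine (real_inner_le_norm _ _).trans ?_
    rw [pow_two, ← mul_assoc]
    exact mul_le_mul_of_nonneg_right (hnorm i hi) (norm_nonneg _)
  -- The bounds add up to an equality, so each of them is one; together with `hnorm` this puts every
  -- `L (v i)` on the ray of `L w`.
  have hieq := (Finset.sum_eq_sum_iff_of_le hinner).1 (by
    rw [← sum_inner, hsum, ← Finset.sum_mul, hμ1, one_mul, real_inner_self_eq_norm_sq])
  have hfinal : L (v i) = L (μ i • w) := by
    rw [map_smul, ← sub_eq_zero, ← norm_eq_zero, ← sq_eq_zero_iff]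
    refine le_antisymm ?_ (sq_nonneg _)
    rw [norm_sub_sq_real, real_inner_smul_right, hieq i hi, norm_smul, Real.norm_eq_abs,
      abs_of_nonneg (hμ0 i)]
    have := pow_le_pow_left₀ (norm_nonneg _) (hnorm i hi) 2
    nlinarith
  have := congrArg Subtype.val (L.injective hfinal)
  rw [hρw]
  exact this

/-! ### Dilations of pure states -/

theorem StronglyCausal.exists_isPure (hT : T.StronglyCausal) (hfin : T.FiniteDimensionalStates)
    (hcl : T.ClosedStates) (A : S) : ∃ ρ : 𝟙_ S ⟶ A, T.IsDeterministic ρ ∧ T.IsPure ρ := by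
  let F : Set ((A ⟶ 𝟙_ S) → ℝ) := Set.range (T.stateVec (A := A)) ∩ {x | x (T.discard A) = 1}
  obtain ⟨ρ, h1, h2, -⟩ := hT.exists_isPure_isMaxOn hfin (F := F)
    ((hcl A).inter (isClosed_eq (continuous_apply _) continuous_const)) (by
      obtain ⟨ρ, hρ⟩ := T.exists_isDeterministic_state A
      exact ⟨_, ⟨ρ, rfl⟩, hρ.prob_discard⟩) (by
      rintro _ ⟨⟨ρ, rfl⟩, hρ⟩
      exact hT.exists_isDeterministic_of_prob_eq_one hρ) (by
      intro ρ X _ t Y _ _ i _ hpos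
      obtain ⟨χ, hχ, he⟩ := hT.exists_normalized hcl hpos
      rw [← he]
      exact ⟨⟨χ, rfl⟩, hχ.prob_discard⟩) 0
  exact ⟨ρ, h1, h2⟩

/-- A local transformation that fixes a pure state acts trivially on all its dilations. -/
theorem StronglyCausal.stateVec_dilation_comp (hT : T.StronglyCausal)
    (hfin : T.FiniteDimensionalStates) (hcl : T.ClosedStates)
    (hup : T.EssentiallyUniquePurification) (hat : T.AtomicParallelComposition) {A C : S}
    {φ : 𝟙_ S ⟶ A} (hφ : T.IsDeterministic φ) (hpure : T.IsPure φ) {g : A ⟶ A}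
    (hg : T.stateVec (φ ≫ g) = T.stateVec φ) {Ω : 𝟙_ S ⟶ A ⊗ C} (hΩ : T.IsDilation φ Ω) :
    T.stateVec (Ω ≫ g ▷ C) = T.stateVec Ω := by
  obtain ⟨e, he, hm⟩ := hΩ
  obtain ⟨η, hη, hηp⟩ := hT.exists_isPure hfin hcl C
  have hmd : T.IsDeterministic (A ◁ e ≫ (ρ_ A).hom) :=
    (he.whiskerLeft A).comp (T.test_rightUnitor_hom A)
  -- The states whose marginal under the given effect `e` is `φ`.
  let F : Set ((A ⊗ C ⟶ 𝟙_ S) → ℝ) := Set.range (T.stateVec (A := A ⊗ C)) ∩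
    {x | ∀ a : A ⟶ 𝟙_ S, x (A ◁ e ≫ (ρ_ A).hom ≫ a) = T.stateVec φ a}
  have hFmem : ∀ ω : 𝟙_ S ⟶ A ⊗ C, T.stateVec ω ∈ F ↔
      T.stateVec φ = T.stateVec (ω ≫ A ◁ e ≫ (ρ_ A).hom) := by
    intro ω
    refine ⟨fun h => ?_, fun h => ⟨⟨ω, rfl⟩, fun a => ?_⟩⟩
    · funext a
      simpa [stateVec] using (h.2 a).symm
    · simpa [stateVec] using (congrFun h a).symm
  have hFprob : ∀ ω : 𝟙_ S ⟶ A ⊗ C, T.stateVec ω ∈ F → T.prob (ω ≫ T.discard _) = 1 := by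
    intro ω hω
    have := congrFun ((hFmem ω).1 hω) (T.discard A)
    rw [stateVec, hφ.prob_discard, stateVec, Category.assoc,
      hT.prob_deterministic_comp ω hmd] at this
    exact this.symm
  have hpures : ∀ Ψ : 𝟙_ S ⟶ A ⊗ C, T.IsPure Ψ → T.stateVec Ψ ∈ F →
      T.stateVec (Ψ ≫ g ▷ C) = T.stateVec Ψ := by
    intro Ψ hΨ hΨF
    -- The product with a pure ancilla state is one purification, so every other one is again a
    -- product with first factor `φ`.
    obtain ⟨U, -, hU⟩ := hup φ (parState φ η) Ψ
      ⟨IsDeterministic.isDilation_parState φ hη, hat φ η hpure hηp⟩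
      ⟨⟨e, he, (hFmem Ψ).1 hΨF⟩, hΨ⟩
    rw [stateVec_comp hU, hU, parState_whiskerLeft, parState_whiskerRight]
    have := parState_stateVec_left_smul (ρ' := φ) (c := 1) (by rw [hg, one_smul]) (η ≫ U)
    rw [this, one_smul]
  have hmax : ∀ l : ((A ⊗ C ⟶ 𝟙_ S) → ℝ) →L[ℝ] ℝ, ∃ ρ : 𝟙_ S ⟶ A ⊗ C, T.IsDeterministic ρ ∧
      T.IsPure ρ ∧ T.stateVec ρ ∈ F ∧ ∀ x ∈ F, l x ≤ l (T.stateVec ρ) := by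
    refine hT.exists_isPure_isMaxOn hfin ((hcl _).inter ?_) ⟨_, (hFmem Ω).2 hm⟩ ?_ ?_
    · simp only [Set.ofPred_forall]
      exact isClosed_iInter fun a => isClosed_eq (continuous_apply _) continuous_const
    · rintro _ ⟨⟨ω, rfl⟩, hω⟩
      exact hT.exists_isDeterministic_of_prob_eq_one (hFprob ω ⟨⟨ω, rfl⟩, hω⟩)
    · intro ω X _ t Y hω ht i hi hpos
      obtain ⟨χ, hχ, hχt⟩ := hT.exists_normalized hcl hpos
      rw [← hχt, hFmem, stateVec_comp_smul hχt]
      have ht' : T.IsRefinement φ (fun i => t i ≫ A ◁ e ≫ (ρ_ A).hom) Y :=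
        ⟨(ht.comp hmd).1, ((hFmem ω).1 hω).trans (ht.comp hmd).2⟩
      -- The marginals of the refinement refine the pure state `φ`, hence are multiples of it;
      -- normalization fixes the factor.
      rw [hpure.stateVec_eq hφ ht' hi, Category.assoc, hT.prob_deterministic_comp _ hmd, smul_smul,
        inv_mul_cancel₀ hpos.ne', one_smul]
  funext a
  -- `l` is the change of the probability of `a` caused by `g`. It vanishes at the pure states of
  -- `F`, where both `l` and `-l` attain their maxima.
  let l : ((A ⊗ C ⟶ 𝟙_ S) → ℝ) →L[ℝ] ℝ :=
    ContinuousLinearMap.proj (R := ℝ) (φ := fun _ : (A ⊗ C ⟶ 𝟙_ S) => ℝ) (g ▷ C ≫ a) -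
      ContinuousLinearMap.proj (R := ℝ) (φ := fun _ : (A ⊗ C ⟶ 𝟙_ S) => ℝ) a
  have hl : ∀ ω : 𝟙_ S ⟶ A ⊗ C, l (T.stateVec ω) =
      T.stateVec (ω ≫ g ▷ C) a - T.stateVec ω a := by
    intro ω
    simp [l, stateVec]
  have hle : l (T.stateVec Ω) ≤ 0 := by
    obtain ⟨Ψ, -, h1, h2, h3⟩ := hmax l
    refine (h3 _ ((hFmem Ω).2 hm)).trans ?_
    rw [hl, hpures Ψ h1 h2, sub_self]
  have hge : (-l) (T.stateVec Ω) ≤ 0 := by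
    obtain ⟨Ψ, -, h1, h2, h3⟩ := hmax (-l)
    refine (h3 _ ((hFmem Ω).2 hm)).trans ?_
    rw [neg_apply, hl, hpures Ψ h1 h2, sub_self, neg_zero]
  rw [neg_apply, hl] at hge
  rw [hl] at hle
  linarith

/-- A local transformation that fixes a pure state acts trivially on the refinements of its
dilations. -/
theorem StronglyCausal.stateVec_refinement_comp (hT : T.StronglyCausal)
    (hfin : T.FiniteDimensionalStates) (hcl : T.ClosedStates)
    (hup : T.EssentiallyUniquePurification) (hat : T.AtomicParallelComposition) {A C : S}
    {φ : 𝟙_ S ⟶ A} (hφ : T.IsDeterministic φ) (hpure : T.IsPure φ) {g : A ⟶ A}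
    (hg : T.stateVec (φ ≫ g) = T.stateVec φ) {Ω : 𝟙_ S ⟶ A ⊗ C} (hΩ : T.IsDilation φ Ω)
    {X : Type} [Finite X] {t : X → (𝟙_ S ⟶ A ⊗ C)} {Y : Finset X} (ht : T.IsRefinement Ω t Y)
    {i : X} (hi : i ∈ Y) : T.stateVec (t i ≫ g ▷ C) = T.stateVec (t i) := by
  obtain ⟨e, he, hm⟩ := hΩ
  have hmd : T.IsDeterministic (A ◁ e ≫ (ρ_ A).hom) :=
    (he.whiskerLeft A).comp (T.test_rightUnitor_hom A)
  rcases (T.prob_nonneg (t i ≫ T.discard _)).eq_or_lt with h0 | hpos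
  · have hz : T.stateVec (t i) = (0 : ℝ) • T.stateVec (t i) := by
      rw [zero_smul, hT.stateVec_eq_zero h0.symm]
    rw [stateVec_comp_smul hz, hz, zero_smul, zero_smul]
  · obtain ⟨χ, hχ, hχt⟩ := hT.exists_normalized hcl hpos
    have ht' : T.IsRefinement φ (fun i => t i ≫ A ◁ e ≫ (ρ_ A).hom) Y :=
      ⟨(ht.comp hmd).1, hm.trans (ht.comp hmd).2⟩
    have hχd : T.IsDilation φ χ := ⟨e, he, by
      rw [stateVec_comp_smul hχt, hpure.stateVec_eq hφ ht' hi, Category.assoc,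
        hT.prob_deterministic_comp _ hmd, smul_smul, inv_mul_cancel₀ hpos.ne', one_smul]⟩
    have hfix := hT.stateVec_dilation_comp hfin hcl hup hat hφ hpure hg hχd
    have hti : T.stateVec (t i) = T.prob (t i ≫ T.discard _) • T.stateVec χ := by
      rw [hχt, smul_smul, mul_inv_cancel₀ hpos.ne', one_smul]
    rw [stateVec_comp_smul hti, hfix, ← hti]

/-! ### Compression of pure states -/

theorem isPure_id (T : OPT S) : T.IsPure (𝟙 (𝟙_ S)) := by
  intro X _ t Y _ i _
  refine ⟨T.prob (t i), T.prob_nonneg _, T.prob_le_one _, ?_⟩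
  rw [← stateVec_scalar_comp, Category.comp_id]

theorem AtomicParallelComposition.isPure_statePow (hat : T.AtomicParallelComposition) {A : S}
    {φ : 𝟙_ S ⟶ A} (hφ : T.IsPure φ) : ∀ N, T.IsPure (statePow φ N)
  | 0 => isPure_id T
  | N + 1 => hat _ _ (hat.isPure_statePow hφ N) hφ

theorem opNorm_zero (T : OPT S) (A : S) : T.opNorm (A := A) 0 = 0 := by
  refine le_antisymm (Real.sSup_nonpos ?_) (Real.sSup_nonneg ?_) <;>
  · rintro r ⟨X, _, t, i, -, rfl⟩
    simp

/-- The scheme discards the input and prepares `statePow φ N` anew. The state passed in between is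
irrelevant, so any `M` works and the error is exactly 0. -/
theorem StronglyCausal.exists_exact_scheme (hT : T.StronglyCausal)
    (hfin : T.FiniteDimensionalStates) (hcl : T.ClosedStates)
    (hup : T.EssentiallyUniquePurification) (hat : T.AtomicParallelComposition) {A : S} (B : S)
    {φ : 𝟙_ S ⟶ A} (hφ : T.IsDeterministic φ) (hpure : T.IsPure φ) (N M : ℕ) {ε : ℝ}
    (hε : 0 < ε) : (T.reliableSchemes B φ N M ε).Nonempty := by
  obtain ⟨b, hb⟩ := T.exists_isDeterministic_state (sysPow B M)
  have hE : T.IsDeterministic (T.discard (sysPow A N) ≫ b) := (T.isDeterministic_discard _).comp hb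
  have hD : T.IsDeterministic (T.discard (sysPow B M) ≫ statePow φ N) :=
    (T.isDeterministic_discard _).comp (hφ.statePow N)
  refine ⟨⟨T.discard _ ≫ b, T.discard _ ≫ statePow φ N⟩, hE, hD, ?_⟩
  refine lt_of_le_of_lt (sSup_le ?_) (EReal.coe_pos.2 hε)
  rintro r ⟨C, Ω, X, _, t, Y, hΩ, ht, rfl⟩
  have hg : T.stateVec (statePow φ N ≫ (T.discard (sysPow A N) ≫ b) ≫
      T.discard (sysPow B M) ≫ statePow φ N) = T.stateVec (statePow φ N) := by
    have := stateVec_scalar_comp (T := T)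
      (statePow φ N ≫ T.discard (sysPow A N) ≫ b ≫ T.discard (sysPow B M)) (statePow φ N)
    rw [prob_of_isDeterministic ((hφ.statePow N).comp ((T.isDeterministic_discard _).comp
      (hb.comp (T.isDeterministic_discard _)))), one_smul] at this
    simpa using this
  rw [Finset.sum_eq_zero, EReal.coe_zero]
  intro i hi
  rw [hT.stateVec_refinement_comp hfin hcl hup hat (hφ.statePow N) (hat.isPure_statePow hpure N) hg
    hΩ ht hi, sub_self, opNorm_zero]

theorem StronglyCausal.infoContent_eq_zero (hT : T.StronglyCausal)
    (hfin : T.FiniteDimensionalStates) (hcl : T.ClosedStates)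
    (hup : T.EssentiallyUniquePurification) (hat : T.AtomicParallelComposition) {A : S} (B : S)
    {φ : 𝟙_ S ⟶ A} (hφ : T.IsDeterministic φ) (hpure : T.IsPure φ) : T.infoContent B φ = 0 := by
  have h : ∀ ε : ℝ, 0 < ε → T.asymptoticRatio B φ ε = 0 := by
    intro ε hε
    have hle : ∀ N : ℕ, T.compressionRatio B φ N ε ≤ (N : ℝ≥0∞)⁻¹ := by
      intro N
      rw [← one_div]
      refine ENNReal.div_le_div_right (iInf₂_le_of_le 1 ⟨one_pos, ?_⟩ (by simp)) _
      exact hT.exists_exact_scheme hfin hcl hup hat B hφ hpure N 1 hε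
    exact (tendsto_of_tendsto_of_tendsto_of_le_of_le tendsto_const_nhds
      ENNReal.tendsto_inv_nat_nhds_zero (fun _ => zero_le) hle).limsup_eq
  refine tendsto_nhds_unique (T.tendsto_infoContent B φ) (tendsto_const_nhds.congr' ?_)
  filter_upwards [self_mem_nhdsWithin] with ε hε
  exact (h ε hε).symm

end OPT

/-! ### Finite-dimensional estimates -/

/-- A finite family of vectors has a barycentric spanner: a subfamily, of the dimension of the span,
of which every vector of the family is a combination with coefficients of modulus at most one. -/
theorem exists_barycentric_spanner {ι V : Type*} [Finite ι] [AddCommGroup V] [Module ℝ V]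
    [FiniteDimensional ℝ V] (v : ι → V) :
    ∃ f : Fin (Module.finrank ℝ (Submodule.span ℝ (Set.range v))) → ι, ∀ i,
      ∃ c : Fin (Module.finrank ℝ (Submodule.span ℝ (Set.range v))) → ℝ,
        (∀ k, |c k| ≤ 1) ∧ v i = ∑ k, c k • v (f k) := by
  classical
  set W := Submodule.span ℝ (Set.range v) with hW
  set d := Module.finrank ℝ W with hd
  let v' : ι → W := fun i => ⟨v i, Submodule.subset_span ⟨i, rfl⟩⟩
  have hspan : Submodule.span ℝ (Set.range v') = ⊤ := by
    have h := Submodule.span_span_coe_preimage (R := ℝ) (s := Set.range v)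
    rw [← h]
    congr 1
    ext ⟨x, hx⟩
    simp [v']
  let b : Module.Basis (Fin d) ℝ W := Module.finBasis ℝ W
  obtain ⟨κ, a, -, ha, hli⟩ := exists_linearIndependent' ℝ v'
  let b₀ : Module.Basis κ ℝ W := Module.Basis.mk hli (by rw [ha, hspan])
  let e : Fin d ≃ κ := b.indexEquiv b₀
  have hf₀ : b.det (v' ∘ a ∘ e) ≠ 0 := by
    have : v' ∘ a ∘ e = b₀.reindex e.symm := by
      funext k; simp [b₀]
    rw [this]
    exact (b.isUnit_det _).ne_zero
  have : Nonempty (Fin d → ι) := ⟨a ∘ e⟩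
  -- The spanner is a subfamily of largest volume. By Cramer's rule a coefficient is a ratio of
  -- determinants, with a maximal denominator.
  obtain ⟨f, hf⟩ := Finite.exists_max fun f : Fin d → ι => |b.det (v' ∘ f)|
  have hpos : 0 < |b.det (v' ∘ f)| := (abs_pos.2 hf₀).trans_le (hf (a ∘ e))
  obtain ⟨hli', hsp'⟩ := (b.is_basis_iff_det (v := v' ∘ f)).2 (abs_pos.1 hpos).isUnit
  let b' : Module.Basis (Fin d) ℝ W := Module.Basis.mk hli' hsp'.ge
  have hb' : ∀ k, b' k = v' (f k) := fun k => by simp [b']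
  refine ⟨f, fun i => ⟨fun k => b'.repr (v' i) k, fun k => ?_, ?_⟩⟩
  · have hexp := b'.sum_repr (v' i)
    have hupd : v' ∘ Function.update f k i = Function.update (v' ∘ f) k (v' i) :=
      Function.comp_update _ _ _ _
    have hdet : b.det (v' ∘ Function.update f k i) = b'.repr (v' i) k * b.det (v' ∘ f) := by
      rw [hupd, ← hexp, AlternatingMap.map_update_sum, Finset.sum_eq_single k]
      · rw [AlternatingMap.map_update_smul, hb', hexp, smul_eq_mul]
        congr 2
        exact Function.update_eq_self _ _
      · intro j _ hj
        rw [AlternatingMap.map_update_smul, hb']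
        have h0 := b.det.map_update_self (v' ∘ f) hj.symm
        rw [Function.comp_apply] at h0
        rw [h0, smul_zero]
      · simp
    have := hf (Function.update f k i)
    rw [hdet, abs_mul] at this
    exact le_of_mul_le_mul_right (by simpa using this) hpos
  · have hexp := congrArg Subtype.val (b'.sum_repr (v' i))
    simp only [hb', AddSubmonoidClass.coe_finsetSum, Submodule.coe_smul] at hexp
    exact hexp.symm

/-- A guessing bound: correlations of rank `d` exceed product correlations by a factor `d` at
most. -/
theorem sum_filter_le_finrank_mul {X Y : Type*} [Fintype X] [Fintype Y] {w : X → Y → ℝ}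
    (hw : ∀ s y, 0 ≤ w s y) (R : X → Y → Prop) [∀ s y, Decidable (R s y)] {η : ℝ} (hη : 0 ≤ η)
    (hR : ∀ y, ∑ s with R s y, ∑ y', w s y' ≤ η) :
    ∑ s, ∑ y with R s y, w s y ≤ Module.finrank ℝ (Submodule.span ℝ (Set.range w)) * η := by
  set p : X → ℝ := fun s => ∑ y, w s y with hp
  have hp0 : ∀ s, 0 ≤ p s := fun s => Finset.sum_nonneg fun y _ => hw s y
  -- Conditional distributions; a row of weight zero becomes 0, whence only `≤ 1` in `hv1`.
  let v : X → Y → ℝ := fun s => (p s)⁻¹ • w s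
  have hv0 : ∀ s y, 0 ≤ v s y := fun s y => mul_nonneg (inv_nonneg.2 (hp0 s)) (hw s y)
  have hv1 : ∀ s, ∑ y, v s y ≤ 1 := by
    intro s
    simp only [v, Pi.smul_apply, smul_eq_mul, ← Finset.mul_sum]
    exact inv_mul_le_one
  have hwv : ∀ s y, w s y = p s * v s y := by
    intro s y
    rcases (hp0 s).eq_or_lt with h | h
    · rw [← h, zero_mul]
      exact (Finset.sum_eq_zero_iff_of_nonneg fun y _ => hw s y).1 h.symm y (Finset.mem_univ y)
    · simp [v, mul_inv_cancel_left₀ h.ne']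
  obtain ⟨f, hf⟩ := exists_barycentric_spanner v
  -- Domination by a sum that no longer depends on `s`: this decouples the two variables, at the
  -- cost of one term per dimension.
  have hvle : ∀ s y, v s y ≤ ∑ k, v (f k) y := by
    intro s y
    obtain ⟨c, hc, he⟩ := hf s
    rw [he, Finset.sum_apply]
    refine Finset.sum_le_sum fun k _ => ?_
    exact mul_le_of_le_one_left (hv0 _ _) ((le_abs_self _).trans (hc k))
  have hdim : Module.finrank ℝ (Submodule.span ℝ (Set.range v)) ≤
      Module.finrank ℝ (Submodule.span ℝ (Set.range w)) := by
    refine Submodule.finrank_mono (Submodule.span_le.2 ?_)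
    rintro _ ⟨s, rfl⟩
    exact Submodule.smul_mem _ _ (Submodule.subset_span ⟨s, rfl⟩)
  calc ∑ s, ∑ y with R s y, w s y
      ≤ ∑ s, ∑ y with R s y, ∑ k, p s * v (f k) y := by
        refine Finset.sum_le_sum fun s _ => Finset.sum_le_sum fun y _ => ?_
        rw [hwv, ← Finset.mul_sum]
        exact mul_le_mul_of_nonneg_left (hvle s y) (hp0 s)
    _ = ∑ k, ∑ y, v (f k) y * ∑ s with R s y, p s := by
        have hite : ∀ s y, (if R s y then ∑ k, p s * v (f k) y else 0) =
            ∑ k, if R s y then v (f k) y * p s else 0 := fun s y => by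
          split_ifs <;> simp [mul_comm]
        simp only [Finset.sum_filter, Finset.mul_sum, mul_ite, mul_zero, hite]
        rw [Finset.sum_comm, Finset.sum_comm (s := Finset.univ (α := Fin _))]
        exact Finset.sum_congr rfl fun y _ => Finset.sum_comm
    _ ≤ ∑ k, ∑ y, v (f k) y * η := by
        refine Finset.sum_le_sum fun k _ => Finset.sum_le_sum fun y _ => ?_
        exact mul_le_mul_of_nonneg_left (hR y) (hv0 _ _)
    _ ≤ ∑ k : Fin (Module.finrank ℝ (Submodule.span ℝ (Set.range v))), η := by
        refine Finset.sum_le_sum fun k _ => ?_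
        rw [← Finset.sum_mul]
        exact mul_le_of_le_one_left hη (hv1 _)
    _ ≤ _ := by
        rw [Finset.sum_const, Finset.card_univ, Fintype.card_fin, nsmul_eq_mul]
        exact mul_le_mul_of_nonneg_right (by exact_mod_cast hdim) hη

/-- The Bhattacharyya coefficient of a joint distribution and the product of its marginals. -/
noncomputable def marginalFidelity {X Y : Type*} [Fintype X] [Fintype Y] (J : X → Y → ℝ) : ℝ :=
  ∑ s, ∑ y, √(J s y * ((∑ y', J s y') * ∑ s', J s' y))

theorem marginalFidelity_nonneg {X Y : Type*} [Fintype X] [Fintype Y] (J : X → Y → ℝ) :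
    0 ≤ marginalFidelity J :=
  Finset.sum_nonneg fun _ _ => Finset.sum_nonneg fun _ _ => Real.sqrt_nonneg _

theorem marginalFidelity_prod {X Y X' Y' : Type*} [Fintype X] [Fintype Y] [Fintype X'] [Fintype Y']
    {J : X → Y → ℝ} {J' : X' → Y' → ℝ} (hJ : ∀ s y, 0 ≤ J s y) :
    marginalFidelity (fun (p : X × X') (q : Y × Y') => J p.1 q.1 * J' p.2 q.2) =
      marginalFidelity J * marginalFidelity J' := by
  have hp : ∀ s, 0 ≤ ∑ y', J s y' := fun s => Finset.sum_nonneg fun _ _ => hJ _ _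
  have hq : ∀ y, 0 ≤ ∑ s', J s' y := fun y => Finset.sum_nonneg fun _ _ => hJ _ _
  unfold marginalFidelity
  simp only [Fintype.sum_prod_type, ← Finset.mul_sum, ← Finset.sum_mul]
  have hsqrt : ∀ s s' y y', √(J s y * J' s' y' * (((∑ y', J s y') * ∑ y, J' s' y) *
      ((∑ s', J s' y) * ∑ s, J' s y'))) = √(J s y * ((∑ y', J s y') * ∑ s', J s' y)) *
      √(J' s' y' * ((∑ y, J' s' y) * ∑ s, J' s y')) := by
    intro s s' y y'
    rw [← Real.sqrt_mul (mul_nonneg (hJ _ _) (mul_nonneg (hp s) (hq y)))]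
    congr 1
    ring
  simp only [hsqrt, ← Finset.mul_sum, ← Finset.sum_mul]

/-- The inequality of arithmetic and geometric means, summed over all entries; it is strict at an
entry where the joint law differs from the product. -/
theorem marginalFidelity_lt_one {X Y : Type*} [Fintype X] [Fintype Y] {J : X → Y → ℝ}
    (hJ : ∀ s y, 0 ≤ J s y) (h1 : ∑ s, ∑ y, J s y = 1) {s : X} {y : Y}
    (hne : J s y ≠ (∑ y', J s y') * ∑ s', J s' y) : marginalFidelity J < 1 := by
  have hp : ∀ s, 0 ≤ ∑ y', J s y' := fun s => Finset.sum_nonneg fun _ _ => hJ _ _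
  have hq : ∀ y, 0 ≤ ∑ s', J s' y := fun y => Finset.sum_nonneg fun _ _ => hJ _ _
  have key : ∀ a b : ℝ, 0 ≤ a → 0 ≤ b → √(a * b) = (a + b) / 2 - (√a - √b) ^ 2 / 2 := by
    intro a b ha hb
    rw [Real.sqrt_mul ha, sub_sq, Real.sq_sqrt ha, Real.sq_sqrt hb]
    ring
  have hsum : ∑ s, ∑ y, (J s y + (∑ y', J s y') * ∑ s', J s' y) / 2 = 1 := by
    have h2 : ∑ y, ∑ s', J s' y = 1 := by rw [Finset.sum_comm]; exact h1
    simp only [← Finset.sum_div, Finset.sum_add_distrib, ← Finset.mul_sum, ← Finset.sum_mul, h2, h1]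
    norm_num
  rw [← hsum]
  refine Finset.sum_lt_sum (fun s _ => Finset.sum_le_sum fun y _ => ?_) ⟨s, Finset.mem_univ s,
    Finset.sum_lt_sum (fun y _ => ?_) ⟨y, Finset.mem_univ y, ?_⟩⟩
  · rw [key _ _ (hJ s y) (mul_nonneg (hp s) (hq y))]
    linarith [sq_nonneg (√(J s y) - √((∑ y', J s y') * ∑ s', J s' y))]
  · rw [key _ _ (hJ s y) (mul_nonneg (hp s) (hq y))]
    linarith [sq_nonneg (√(J s y) - √((∑ y', J s y') * ∑ s', J s' y))]
  · rw [key _ _ (hJ s y) (mul_nonneg (hp s) (hq y))]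
    have hsq : √(J s y) - √((∑ y', J s y') * ∑ s', J s' y) ≠ 0 := by
      rw [sub_ne_zero, Ne, Real.sqrt_inj (hJ s y) (mul_nonneg (hp s) (hq y))]
      exact hne
    linarith [sq_pos_of_ne_zero hsq]

namespace OPT

section Monoidal

variable {S : Type u} [Category.{v} S] [MonoidalCategory S]

/-- Copies of a system can be split into two groups. -/
def sysPowIso (B : S) (M : ℕ) : ∀ M', sysPow B M ⊗ sysPow B M' ≅ sysPow B (M + M')
  | 0 => ρ_ _
  | M' + 1 => (α_ _ _ _).symm ≪≫ whiskerRightIso (sysPowIso B M M') B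

end Monoidal

variable {S : Type u} [Category.{v} S] [MonoidalCategory S] [SymmetricCategory S] {T : OPT S}

/-! ### Sizes of composite systems -/

/-- The rows are images of state vectors under the linear restriction to the chosen effects. -/
theorem finrank_span_le_size (hfin : T.FiniteDimensionalStates) {A : S} {X Y : Type*}
    [Finite Y] (t : X → (𝟙_ S ⟶ A)) (a : Y → (A ⟶ 𝟙_ S)) :
    Module.finrank ℝ (Submodule.span ℝ (Set.range fun s y => T.prob (t s ≫ a y))) ≤ T.size A := by
  have := hfin A
  let L : ((A ⟶ 𝟙_ S) → ℝ) →ₗ[ℝ] (Y → ℝ) := LinearMap.funLeft ℝ ℝ a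
  refine le_trans (Submodule.finrank_mono (t := (T.stateSpace A).map L) ?_)
    (Submodule.finrank_map_le L _)
  rw [Submodule.span_le]
  rintro _ ⟨s, rfl⟩
  exact ⟨T.stateVec (t s), Submodule.subset_span ⟨t s, rfl⟩, rfl⟩

theorem size_le_of_iso (hfin : T.FiniteDimensionalStates) {A B : S} (e : A ≅ B) :
    T.size B ≤ T.size A := by
  have := hfin A
  let L : ((A ⟶ 𝟙_ S) → ℝ) →ₗ[ℝ] ((B ⟶ 𝟙_ S) → ℝ) := LinearMap.funLeft ℝ ℝ fun b => e.hom ≫ b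
  refine le_trans (Submodule.finrank_mono (t := (T.stateSpace A).map L) ?_)
    (Submodule.finrank_map_le L _)
  refine Submodule.span_le.2 ?_
  rintro _ ⟨σ, rfl⟩
  refine ⟨T.stateVec (σ ≫ e.inv), Submodule.subset_span ⟨_, rfl⟩, ?_⟩
  funext b
  simp [L, LinearMap.funLeft, stateVec]

/-! ### Scaling of pure states -/

/-- Preceding a refinement of `χ` by a test that contains the scalar `s` gives a refinement of `φ`.
-/
theorem IsPure.of_smul {A : S} {φ χ : 𝟙_ S ⟶ A} (hφ : T.IsPure φ) {s : 𝟙_ S ⟶ 𝟙_ S}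
    (hs : 0 < T.prob s) (h : T.stateVec φ = T.prob s • T.stateVec χ) : T.IsPure χ := by
  intro X _ t Y ht i hi
  obtain ⟨K, _, w, k, hw, rfl⟩ := T.event_mem_test s
  have href : T.IsRefinement φ (fun p : K × X => w p.1 ≫ t p.2) ({k} ×ˢ Y) := by
    refine ⟨T.test_comp _ _ hw ht.1, ?_⟩
    rw [Finset.sum_product, Finset.sum_singleton, h, ht.2, Finset.smul_sum]
    exact Finset.sum_congr rfl fun i _ => (stateVec_scalar_comp _ _).symm
  obtain ⟨c, h0, h1, hc⟩ := hφ _ _ _ href (k, i) (by simp [hi])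
  refine ⟨c, h0, h1, ?_⟩
  rw [stateVec_scalar_comp, h, smul_comm] at hc
  exact smul_right_injective _ hs.ne' hc

/-- A refinement of `φ` extends to one of `χ`: at every outcome outside it the system is discarded
and `χ` is prepared instead. -/
theorem StronglyCausal.isPure_of_smul (hT : T.StronglyCausal) {A : S} {φ χ : 𝟙_ S ⟶ A}
    (hχ : T.IsDeterministic χ) (hpure : T.IsPure χ) {c : ℝ}
    (h : T.stateVec φ = c • T.stateVec χ) : T.IsPure φ := by
  classical
  intro X _ t Y ht i hi
  have := Fintype.ofFinite X
  have hc : T.prob (φ ≫ T.discard A) = c := by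
    have := congrFun h (T.discard A)
    simpa [stateVec, hχ.prob_discard] using this
  have hsum : ∑ i ∈ Y, T.prob (t i ≫ T.discard A) = c := by
    rw [← hc, ht.sum_prob]
  have hle : T.prob (t i ≫ T.discard A) ≤ c := by
    rw [← hsum]
    exact Finset.single_le_sum (f := fun i => T.prob (t i ≫ T.discard A))
      (fun i _ => T.prob_nonneg _) hi
  have h0 : 0 ≤ T.prob (t i ≫ T.discard A) := T.prob_nonneg _
  rcases h0.eq_or_lt with hz | hpos
  · exact ⟨0, le_rfl, zero_le_one, by rw [hT.stateVec_eq_zero hz.symm, zero_smul]⟩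
  have hcpos := hpos.trans_le hle
  have href : T.IsRefinement χ (fun x => t x ≫ if x ∈ Y then 𝟙 A else T.discard A ≫ χ)
      Finset.univ := by
    refine ⟨hT.conditional _ ht.1 fun x => ?_, ?_⟩
    · split_ifs
      exacts [T.test_id A, (T.isDeterministic_discard A).comp hχ]
    · have h1 : ∑ x ∈ Y, T.stateVec (t x ≫ if x ∈ Y then 𝟙 A else T.discard A ≫ χ) =
          c • T.stateVec χ := by
        rw [← h, ht.2]
        exact Finset.sum_congr rfl fun x hx => by rw [if_pos hx, Category.comp_id]
      have h2 : ∑ x ∈ Yᶜ, T.stateVec (t x ≫ if x ∈ Y then 𝟙 A else T.discard A ≫ χ) =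
          (1 - c) • T.stateVec χ := by
        have h3 := ht.1.sum_prob_discard
        rw [← Finset.sum_add_sum_compl Y, hsum] at h3
        rw [← h3, add_sub_cancel_left, Finset.sum_smul]
        refine Finset.sum_congr rfl fun x hx => ?_
        rw [if_neg (Finset.mem_compl.1 hx), ← Category.assoc, stateVec_scalar_comp]
      rw [← Finset.sum_add_sum_compl Y, h1, h2, ← add_smul, add_sub_cancel, one_smul]
  have he := hpure.stateVec_eq hχ href (Finset.mem_univ i)
  simp only [if_pos hi, Category.comp_id] at he
  refine ⟨T.prob (t i ≫ T.discard A) / c, div_nonneg h0 hcpos.le, (div_le_one hcpos).2 hle, ?_⟩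
  rw [h, smul_smul, div_mul_cancel₀ _ hcpos.ne', ← he]

/-- Atomicity of parallel composition has to be checked for normalized states only. -/
theorem StronglyCausal.atomicParallelComposition (hT : T.StronglyCausal) (hcl : T.ClosedStates)
    (h : ∀ {A B : S} (φ : 𝟙_ S ⟶ A) (ψ : 𝟙_ S ⟶ B), T.IsDeterministic φ → T.IsDeterministic ψ →
      T.IsPure φ → T.IsPure ψ → T.IsPure (parState φ ψ)) : T.AtomicParallelComposition := by
  have hnorm : ∀ {A : S} (φ : 𝟙_ S ⟶ A), T.IsPure φ → ∃ (χ : 𝟙_ S ⟶ A) (c : ℝ),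
      T.IsDeterministic χ ∧ T.stateVec φ = c • T.stateVec χ ∧ (c = 0 ∨ T.IsPure χ) := by
    intro A φ hφ
    rcases (T.prob_nonneg (φ ≫ T.discard A)).eq_or_lt with h0 | hpos
    · obtain ⟨χ, hχ⟩ := T.exists_isDeterministic_state A
      exact ⟨χ, 0, hχ, by rw [hT.stateVec_eq_zero h0.symm, zero_smul], Or.inl rfl⟩
    · obtain ⟨χ, hχ, he⟩ := hT.exists_normalized hcl hpos
      have he' : T.stateVec φ = T.prob (φ ≫ T.discard A) • T.stateVec χ := by
        rw [he, smul_smul, mul_inv_cancel₀ hpos.ne', one_smul]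
      exact ⟨χ, _, hχ, he', Or.inr (hφ.of_smul hpos he')⟩
  have hzero : ∀ {A : S} (φ : 𝟙_ S ⟶ A), T.stateVec φ = 0 → T.IsPure φ := by
    intro A φ hφ X _ t Y ht i hi
    refine ⟨0, le_rfl, zero_le_one, ?_⟩
    rw [zero_smul]
    apply hT.stateVec_eq_zero
    have hs := ht.sum_prob (T.discard A)
    have hz : T.prob (φ ≫ T.discard A) = 0 := congrFun hφ _
    rw [hz] at hs
    exact (Finset.sum_eq_zero_iff_of_nonneg fun i _ => T.prob_nonneg _).1 hs i hi
  intro A B φ ψ hφ hψ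
  obtain ⟨φ', c, hφ', hc, hφp⟩ := hnorm φ hφ
  obtain ⟨ψ', d, hψ', hd, hψp⟩ := hnorm ψ hψ
  have hcd : T.stateVec (parState φ ψ) = (c * d) • T.stateVec (parState φ' ψ') := by
    rw [parState_stateVec_left_smul hc, parState_stateVec_right_smul _ hd, smul_smul]
  rcases hφp with rfl | hφp
  · exact hzero _ (by rw [hcd, zero_mul, zero_smul])
  rcases hψp with rfl | hψp
  · exact hzero _ (by rw [hcd, mul_zero, zero_smul])
  exact hT.isPure_of_smul (hφ'.parallel hψ') (h _ _ hφ' hψ' hφp hψp) hcd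

/-! ### Repetition of a refinement -/

theorem parState_parState_tensorμ {A A' C C' : S} (φ : 𝟙_ S ⟶ A) (ψ : 𝟙_ S ⟶ A') (φ' : 𝟙_ S ⟶ C)
    (ψ' : 𝟙_ S ⟶ C') :
    parState (parState φ ψ) (parState φ' ψ') ≫ tensorμ A A' C C' =
      parState (parState φ φ') (parState ψ ψ') := by
  have hunit : (λ_ (𝟙_ S)).inv ≫ ((λ_ (𝟙_ S)).inv ⊗ₘ (λ_ (𝟙_ S)).inv) ≫
      tensorμ (𝟙_ S) (𝟙_ S) (𝟙_ S) (𝟙_ S) =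
      (λ_ (𝟙_ S)).inv ≫ ((λ_ (𝟙_ S)).inv ⊗ₘ (λ_ (𝟙_ S)).inv) := by
    have h := tensor_left_unitality (𝟙_ S) (𝟙_ S)
    have h' : (λ_ (𝟙_ S ⊗ 𝟙_ S)).hom ≫ ((λ_ (𝟙_ S)).inv ⊗ₘ (λ_ (𝟙_ S)).inv) =
        (λ_ (𝟙_ S)).inv ▷ (𝟙_ S ⊗ 𝟙_ S) ≫ tensorμ (𝟙_ S) (𝟙_ S) (𝟙_ S) (𝟙_ S) := by
      rw [h]
      simp
    conv_lhs => rw [MonoidalCategory.tensorHom_def', Category.assoc, ← h',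
      leftUnitor_naturality_assoc, Iso.inv_hom_id_assoc]
  unfold parState
  rw [← tensorHom_comp_tensorHom, Category.assoc, Category.assoc, tensorμ_natural,
    ← tensorHom_comp_tensorHom]
  have := congrArg (· ≫ ((φ ⊗ₘ φ') ⊗ₘ ψ ⊗ₘ ψ')) hunit
  simpa using this

theorem prob_tensorμ_tensorδ {A A' C C' : S} (ρ : 𝟙_ S ⟶ A ⊗ A') (σ : 𝟙_ S ⟶ C ⊗ C')
    (a : A ⊗ A' ⟶ 𝟙_ S) (b : C ⊗ C' ⟶ 𝟙_ S) :
    T.prob ((parState ρ σ ≫ tensorμ A A' C C') ≫ tensorδ A A' C C' ≫ (a ⊗ₘ b) ≫ (λ_ (𝟙_ S)).hom) =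
      T.prob (ρ ≫ a) * T.prob (σ ≫ b) := by
  rw [← T.prob_comp, Category.assoc, tensorμ_tensorδ_assoc, ← Category.assoc, parState_tensor,
    parState_scalar_left]

theorem stateVec_parState_sum {A B : S} {X Y : Type} [Fintype X] [Fintype Y] {ρ : 𝟙_ S ⟶ A}
    {σ : 𝟙_ S ⟶ B} {t : X → (𝟙_ S ⟶ A)} {r : Y → (𝟙_ S ⟶ B)}
    (ht : T.stateVec ρ = ∑ x, T.stateVec (t x)) (hr : T.stateVec σ = ∑ y, T.stateVec (r y)) :
    T.stateVec (parState ρ σ) = ∑ p : X × Y, T.stateVec (parState (t p.1) (r p.2)) := by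
  rw [parState_eq_left, stateVec_comp_sum ht, Fintype.sum_prod_type]
  refine Finset.sum_congr rfl fun x _ => ?_
  rw [← parState_eq_left, parState_eq_right, stateVec_comp_sum hr]
  exact Finset.sum_congr rfl fun y _ => by rw [parState_eq_right]

/-- Independent runs of `t` and `a`, with the systems regrouped by `tensorμ` so that all copies of
`A` come before all copies of `A'`. -/
theorem exists_test_statePow {A A' : S} {φ : 𝟙_ S ⟶ A} {ψ : 𝟙_ S ⟶ A'} {X Y : Type} [Fintype X]
    [Fintype Y] {t : X → (𝟙_ S ⟶ A ⊗ A')} (ht : T.IsTest t)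
    (hsum : T.stateVec (parState φ ψ) = ∑ x, T.stateVec (t x)) {a : Y → (A ⊗ A' ⟶ 𝟙_ S)}
    (ha : T.IsTest a) (N : ℕ) :
    ∃ (X' Y' : Type) (_ : Fintype X') (_ : Fintype Y')
      (t' : X' → (𝟙_ S ⟶ sysPow A N ⊗ sysPow A' N)) (a' : Y' → (sysPow A N ⊗ sysPow A' N ⟶ 𝟙_ S)),
      T.IsTest t' ∧ T.IsTest a' ∧
      T.stateVec (parState (statePow φ N) (statePow ψ N)) = ∑ x, T.stateVec (t' x) ∧
      marginalFidelity (fun s y => T.prob (t' s ≫ a' y)) =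
        marginalFidelity (fun s y => T.prob (t s ≫ a y)) ^ N := by
  induction N with
  | zero =>
    refine ⟨Unit, Unit, inferInstance, inferInstance,
      fun _ => parState (statePow φ 0) (statePow ψ 0), fun _ => (λ_ (𝟙_ S)).hom,
      IsDeterministic.parallel (T.test_id _) (T.test_id _), T.test_leftUnitor_hom _, by simp, ?_⟩
    have h : T.prob (parState (statePow φ 0) (statePow ψ 0) ≫ (λ_ (𝟙_ S)).hom) = 1 :=
      prob_of_isDeterministic (IsDeterministic.comp
        (IsDeterministic.parallel (T.test_id _) (T.test_id _)) (T.test_leftUnitor_hom _))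
    simp only [marginalFidelity, h]
    simp
  | succ N ih =>
    obtain ⟨X', Y', _, _, t', a', ht', ha', hsum', hf⟩ := ih
    refine ⟨X' × X, Y' × Y, inferInstance, inferInstance,
      fun p => parState (t' p.1) (t p.2) ≫ tensorμ _ _ _ _,
      fun p => tensorδ _ _ _ _ ≫ (a' p.1 ⊗ₘ a p.2) ≫ (λ_ (𝟙_ S)).hom, ?_, ?_, ?_, ?_⟩
    · exact IsTest.comp_deterministic (IsDeterministic.comp_test (T.test_leftUnitor_inv _)
        (T.test_tensor _ _ ht' ht)) (isDeterministic_tensorμ _ _ _ _)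
    · exact IsDeterministic.comp_test (isDeterministic_tensorδ _ _ _ _)
        (IsTest.comp_deterministic (T.test_tensor _ _ ha' ha) (T.test_leftUnitor_hom _))
    · change T.stateVec (parState (parState _ _) (parState _ _)) = _
      rw [← parState_parState_tensorμ]
      exact stateVec_comp_sum (stateVec_parState_sum hsum' hsum) _
    · rw [pow_succ, ← hf, ← marginalFidelity_prod fun s y => T.prob_nonneg _]
      congr 1
      funext p q
      exact prob_tensorμ_tensorδ _ _ _ _

/-! ### The operational norm -/

/-- With equal normalizations the deterministic effect contributes nothing, and the outcomes in `Z`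
merge into a single effect. -/
theorem StronglyCausal.sum_prob_sub_le_opNorm (hT : T.StronglyCausal) {A : S} {ρ σ : 𝟙_ S ⟶ A}
    (h : T.prob (ρ ≫ T.discard A) = T.prob (σ ≫ T.discard A)) {Y : Type} [Fintype Y]
    {a : Y → (A ⟶ 𝟙_ S)} (ha : T.IsTest a) (Z : Finset Y) :
    2 * ∑ y ∈ Z, (T.prob (ρ ≫ a y) - T.prob (σ ≫ a y)) ≤
      T.opNorm (T.stateVec ρ - T.stateVec σ) := by
  have hz : ∀ (X : Type) (_ : Fintype X) (t : X → (A ⟶ 𝟙_ S)), T.IsTest t →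
      ∑ j, (T.stateVec ρ - T.stateVec σ) (t j) = 0 := by
    intro X _ t ht
    simp only [Pi.sub_apply, stateVec, Finset.sum_sub_distrib, hT.sum_prob_effect _ ht, h, sub_self]
  have hbdd : BddAbove {r : ℝ | ∃ (X : Type) (_ : Fintype X) (t : X → (A ⟶ 𝟙_ S)) (i : X),
      T.IsTest t ∧ r = 2 * (T.stateVec ρ - T.stateVec σ) (t i) -
        ∑ j, (T.stateVec ρ - T.stateVec σ) (t j)} := by
    refine ⟨2, ?_⟩
    rintro r ⟨X, _, t, i, ht, rfl⟩
    rw [hz X _ t ht, Pi.sub_apply, stateVec, stateVec]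
    linarith [T.prob_le_one (ρ ≫ t i), T.prob_nonneg (σ ≫ t i)]
  rcases Z.eq_empty_or_nonempty with rfl | hZ
  · refine le_csSup hbdd ⟨Unit, inferInstance, fun _ => T.discard A, (),
      T.isDeterministic_discard A, ?_⟩
    simp [stateVec, h]
  · obtain ⟨f, hf⟩ := ha.exists_sum hZ
    obtain ⟨X, _, t, i, ht, hi⟩ := T.event_mem_test f
    have := Fintype.ofFinite X
    refine le_csSup hbdd ⟨X, inferInstance, t, i, ht, ?_⟩
    have h1 := hf ρ (𝟙 _)
    have h2 := hf σ (𝟙 _)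
    simp only [Category.comp_id] at h1 h2
    rw [hz X _ t ht, hi, Pi.sub_apply, stateVec, stateVec, h1, h2, Finset.sum_sub_distrib, sub_zero]

/-- A reliable compression scheme hardly changes the statistics of a refinement of a dilation. -/
theorem StronglyCausal.sum_prob_sub_lt (hT : T.StronglyCausal) {A B C : S} {φ : 𝟙_ S ⟶ A}
    {N M : ℕ} {ε : ℝ} {E : sysPow A N ⟶ sysPow B M} {D : sysPow B M ⟶ sysPow A N}
    (hED : (E, D) ∈ T.reliableSchemes B φ N M ε) {Ω : 𝟙_ S ⟶ sysPow A N ⊗ C}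
    (hΩ : T.IsDilation (statePow φ N) Ω) {X Y : Type} [Fintype X] [Fintype Y]
    {t : X → (𝟙_ S ⟶ sysPow A N ⊗ C)} (ht : T.IsTest t)
    (hsum : T.stateVec Ω = ∑ x, T.stateVec (t x)) {a : Y → (sysPow A N ⊗ C ⟶ 𝟙_ S)}
    (ha : T.IsTest a) (Z : X → Finset Y) :
    2 * ∑ x, ∑ y ∈ Z x, (T.prob (t x ≫ a y) - T.prob (t x ≫ (E ≫ D) ▷ C ≫ a y)) < ε := by
  classical
  obtain ⟨hE, hD, herr⟩ := hED
  have hED : T.IsDeterministic ((E ≫ D) ▷ C) := (IsDeterministic.comp hE hD).whiskerRight C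
  have hlt : ∑ x, T.opNorm (T.stateVec (t x ≫ (E ≫ D) ▷ C) - T.stateVec (t x)) < ε := by
    rw [← EReal.coe_lt_coe_iff]
    refine lt_of_le_of_lt ?_ herr
    unfold schemeError
    exact le_sSup ⟨C, Ω, X, inferInstance, t, Finset.univ, hΩ, ⟨ht, hsum⟩, rfl⟩
  refine lt_of_le_of_lt ?_ hlt
  rw [Finset.mul_sum]
  refine Finset.sum_le_sum fun x _ => ?_
  have hnorm : T.prob ((t x ≫ (E ≫ D) ▷ C) ≫ T.discard _) = T.prob (t x ≫ T.discard _) := by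
    rw [Category.assoc, hT.prob_deterministic_comp _ hED]
  -- The norm is that of output minus input. As the total is preserved, the excess of the output on
  -- the complement of `Z x` is its deficit on `Z x`.
  refine le_trans (le_of_eq ?_) (hT.sum_prob_sub_le_opNorm hnorm ha (Z x)ᶜ)
  have h1 := hT.sum_prob_effect (t x ≫ (E ≫ D) ▷ C) ha
  have h2 := hT.sum_prob_effect (t x) ha
  rw [← Finset.sum_add_sum_compl (Z x)] at h1 h2
  simp only [Category.assoc] at h1 hnorm ⊢
  rw [Finset.sum_sub_distrib, Finset.sum_sub_distrib]
  linarith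

/-! ### The converse -/

/-- The correlations of a refinement of two states that can both be compressed are limited by the
size of the compressed systems. -/
theorem StronglyCausal.one_lt_of_reliableSchemes (hT : T.StronglyCausal)
    (hfin : T.FiniteDimensionalStates) {A A' B : S} {φ : 𝟙_ S ⟶ A} {ψ : 𝟙_ S ⟶ A'}
    (hφ : T.IsDeterministic φ) (hψ : T.IsDeterministic ψ) {N M M' : ℕ} {ε : ℝ}
    {E : sysPow A N ⟶ sysPow B M} {D : sysPow B M ⟶ sysPow A N}
    (hED : (E, D) ∈ T.reliableSchemes B φ N M ε)
    {E' : sysPow A' N ⟶ sysPow B M'} {D' : sysPow B M' ⟶ sysPow A' N}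
    (hED' : (E', D') ∈ T.reliableSchemes B ψ N M' ε) {X Y : Type} [Fintype X] [Fintype Y]
    {t : X → (𝟙_ S ⟶ sysPow A N ⊗ sysPow A' N)} (ht : T.IsTest t)
    (hsum : T.stateVec (parState (statePow φ N) (statePow ψ N)) = ∑ x, T.stateVec (t x))
    {a : Y → (sysPow A N ⊗ sysPow A' N ⟶ 𝟙_ S)} (ha : T.IsTest a) {θ : ℝ} (hθ : 0 < θ) :
    1 < ε + √θ * marginalFidelity (fun s y => T.prob (t s ≫ a y)) +
      T.size (sysPow B M ⊗ sysPow B M') * θ⁻¹ := by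
  classical
  set J : X → Y → ℝ := fun s y => T.prob (t s ≫ a y) with hJ
  have hJ0 : ∀ s y, 0 ≤ J s y := fun s y => T.prob_nonneg _
  set p : X → ℝ := fun s => ∑ y, J s y with hp
  set q : Y → ℝ := fun y => ∑ s, J s y with hq
  have hp0 : ∀ s, 0 ≤ p s := fun s => Finset.sum_nonneg fun _ _ => hJ0 _ _
  have hq0 : ∀ y, 0 ≤ q y := fun y => Finset.sum_nonneg fun _ _ => hJ0 _ _
  have htotal : ∑ s, ∑ y, J s y = 1 := by
    simp only [hJ, hT.sum_prob_effect _ ha]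
    exact ht.sum_prob_discard
  -- A likelihood-ratio test of the joint law against the product of its marginals, with threshold
  -- `θ`.
  let R : X → Y → Prop := fun s y => θ * (p s * q y) < J s y
  let Z : X → Finset Y := fun s => {y | R s y}
  have hlow : 1 - √θ * marginalFidelity J ≤ ∑ s, ∑ y ∈ Z s, J s y := by
    have hcompl : ∑ s, ∑ y ∈ (Z s)ᶜ, J s y ≤ √θ * marginalFidelity J := by
      rw [marginalFidelity, Finset.mul_sum]
      refine Finset.sum_le_sum fun s _ => ?_
      rw [Finset.mul_sum]
      refine le_trans (Finset.sum_le_sum fun y hy => ?_) (Finset.sum_le_univ_sum_of_nonneg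
        fun y => mul_nonneg (Real.sqrt_nonneg _) (Real.sqrt_nonneg _))
      rw [← Real.sqrt_mul hθ.le]
      refine Real.le_sqrt_of_sq_le ?_
      have hle : J s y ≤ θ * (p s * q y) := by simpa [Z, R] using hy
      have := mul_le_mul_of_nonneg_left hle (hJ0 s y)
      calc J s y ^ 2 = J s y * J s y := pow_two _
        _ ≤ J s y * (θ * (p s * q y)) := this
        _ = θ * (J s y * (p s * q y)) := by ring
    rw [← htotal]
    have : ∑ s, ∑ y, J s y = ∑ s, ∑ y ∈ Z s, J s y + ∑ s, ∑ y ∈ (Z s)ᶜ, J s y := by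
      rw [← Finset.sum_add_distrib]
      exact Finset.sum_congr rfl fun s _ => (Finset.sum_add_sum_compl _ _).symm
    linarith
  have hE' := hED'.1
  have hD' := hED'.2.1
  -- For the second scheme the roles are exchanged: the `A` copies are the ancilla. In `h1` this
  -- scheme is absorbed into the effects, so the two errors, each below ε/2, add up.
  let β := β_ (sysPow A N) (sysPow A' N)
  have h2 := hT.sum_prob_sub_lt hED' (IsDeterministic.isDilation_parState _ (hφ.statePow N))
    (t := fun s => t s ≫ β.hom) (IsTest.comp_deterministic ht (T.test_braiding _ _)) (by
      rw [← stateVec_comp_sum hsum]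
      congr 1
      simp [parState, β, ← unitors_equal]) (a := fun y => β.inv ≫ a y)
    (IsDeterministic.comp_test (isDeterministic_braiding_inv _ _) ha) Z
  simp only [β, Category.assoc, Iso.hom_inv_id_assoc,
    ← BraidedCategory.braiding_naturality_right_assoc] at h2
  have h1 := hT.sum_prob_sub_lt hED (IsDeterministic.isDilation_parState _ (hψ.statePow N)) ht hsum
    (a := fun y => sysPow A N ◁ (E' ≫ D') ≫ a y)
    (IsDeterministic.comp_test ((IsDeterministic.comp hE' hD').whiskerLeft _) ha) Z
  have hfactor : ∀ s y, t s ≫ (E ≫ D) ▷ sysPow A' N ≫ sysPow A N ◁ (E' ≫ D') ≫ a y =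
      (t s ≫ (E ⊗ₘ E')) ≫ (D ⊗ₘ D') ≫ a y := by
    intro s y
    rw [← MonoidalCategory.tensorHom_def_assoc, ← tensorHom_comp_tensorHom]
    simp only [Category.assoc]
  simp only [hfactor] at h1
  set w : X → Y → ℝ := fun s y => T.prob ((t s ≫ (E ⊗ₘ E')) ≫ (D ⊗ₘ D') ≫ a y) with hw
  have hEE : T.IsDeterministic (E ⊗ₘ E') := IsDeterministic.tensor hED.1 hE'
  have hDD : T.IsDeterministic (D ⊗ₘ D') := IsDeterministic.tensor hED.2.1 hD'
  have hwp : ∀ s, ∑ y, w s y = p s := by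
    intro s
    have h := hT.sum_prob_effect (t s ≫ (E ⊗ₘ E')) (hDD.comp_test ha)
    rw [Category.assoc, hT.prob_deterministic_comp _ hEE, ← hT.sum_prob_effect (t s) ha] at h
    exact h
  -- After compression the correlations pass through the obits, so the guessing bound applies. For
  -- fixed `y`, `p s < J s y / (θ * q y)` on the test region, and summing over `s` gives at most
  -- `θ⁻¹`.
  have hup : ∑ s, ∑ y ∈ Z s, w s y ≤ T.size (sysPow B M ⊗ sysPow B M') * θ⁻¹ := by
    refine (sum_filter_le_finrank_mul (w := w) (fun s y => T.prob_nonneg _) R (inv_nonneg.2 hθ.le)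
      fun y => ?_).trans (mul_le_mul_of_nonneg_right (by
        exact_mod_cast finrank_span_le_size hfin _ _) (inv_nonneg.2 hθ.le))
    simp only [hwp]
    rcases (hq0 y).eq_or_lt with h0 | hpos
    · have hz : ∀ s, J s y = 0 := fun s =>
        (Finset.sum_eq_zero_iff_of_nonneg fun s _ => hJ0 s y).1 h0.symm s (Finset.mem_univ s)
      have hR : ∀ s, ¬ R s y := fun s => by simp [R, hz s, ← h0]
      simp only [hR, Finset.filter_false, Finset.sum_empty]
      exact inv_nonneg.2 hθ.le
    · rw [← one_div, le_div_iff₀ hθ, ← mul_le_mul_iff_left₀ hpos, one_mul, Finset.sum_mul,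
        Finset.sum_mul]
      refine le_trans (Finset.sum_le_sum fun s hs => ?_) (Finset.sum_le_univ_sum_of_nonneg
        fun s => hJ0 s y)
      have : θ * (p s * q y) < J s y := by simpa [R] using hs
      linarith
  have hsplit : ∑ s, ∑ y ∈ Z s, (J s y - w s y) < ε := by
    have : ∑ s, ∑ y ∈ Z s, (J s y - w s y) =
        ∑ s, ∑ y ∈ Z s, (J s y - T.prob (t s ≫ sysPow A N ◁ (E' ≫ D') ≫ a y)) +
        ∑ s, ∑ y ∈ Z s, (T.prob (t s ≫ sysPow A N ◁ (E' ≫ D') ≫ a y) - w s y) := by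
      simp only [← Finset.sum_add_distrib]
      exact Finset.sum_congr rfl fun s _ => Finset.sum_congr rfl fun y _ => by ring
    rw [this]
    linarith
  simp only [Finset.sum_sub_distrib] at hsplit
  linarith

theorem exists_reliableScheme_of_infoContent_eq_zero {A B : S} {φ : 𝟙_ S ⟶ A}
    (h : T.infoContent B φ = 0) {ε δ : ℝ} (hε : 0 < ε) (hδ : 0 < δ) :
    ∀ᶠ N : ℕ in atTop, ∃ M : ℕ, (M : ℝ) ≤ δ * N ∧ (T.reliableSchemes B φ N M ε).Nonempty := by
  have h0 : T.asymptoticRatio B φ ε ≤ 0 := by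
    rw [← h]
    refine ge_of_tendsto (T.tendsto_infoContent B φ) ?_
    filter_upwards [Ioc_mem_nhdsGT hε] with ε' hε'
    exact T.asymptoticRatio_antitone B φ hε'.2
  have hlt : limsup (fun N : ℕ => T.compressionRatio B φ N ε) atTop < ENNReal.ofReal δ :=
    lt_of_le_of_lt h0 (ENNReal.ofReal_pos.2 hδ)
  filter_upwards [eventually_lt_of_limsup_lt hlt, eventually_gt_atTop 0] with N hN hN0
  rw [compressionRatio, ENNReal.div_lt_iff (by simp [hN0.ne']) (by simp), iInf_lt_iff] at hN
  obtain ⟨M, hM⟩ := hN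
  rw [iInf_lt_iff] at hM
  obtain ⟨⟨-, hne⟩, hM⟩ := hM
  refine ⟨M, ?_, hne⟩
  have hM' : ENNReal.ofReal (M : ℝ) ≤ ENNReal.ofReal (δ * N) := by
    rw [ENNReal.ofReal_mul hδ.le, ENNReal.ofReal_natCast, ENNReal.ofReal_natCast]
    exact hM.le
  exact (ENNReal.ofReal_le_ofReal_iff (by positivity)).1 hM'

/-- With L the size of `B`, at least 1, the size is at most k L^(2δN), so δ is chosen with 2δ log L
≤ (log θ)/2. The `+ 1` in its denominator covers L = 1. -/
theorem exists_size_sysPow_le (hfin : T.FiniteDimensionalStates) (hsc : T.RegularScaling) (B : S)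
    {θ : ℝ} (hθ : 1 < θ) : ∃ k δ : ℝ, 0 < k ∧ 0 < δ ∧ ∀ N M M' : ℕ, (M : ℝ) ≤ δ * N →
      (M' : ℝ) ≤ δ * N → (T.size (sysPow B M ⊗ sysPow B M') : ℝ) ≤ k * (√θ) ^ N := by
  obtain ⟨k, hk, hsize⟩ := hsc B
  set L : ℝ := max (T.size B) 1
  have hL : 1 ≤ L := le_max_right _ _
  have hlogL : 0 ≤ Real.log L := Real.log_nonneg hL
  have hlogθ : 0 < Real.log θ := Real.log_pos hθ
  refine ⟨k, Real.log θ / (4 * (Real.log L + 1)), hk, by positivity, fun N M M' hM hM' => ?_⟩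
  set δ := Real.log θ / (4 * (Real.log L + 1)) with hδ
  have h1 : (T.size (sysPow B M ⊗ sysPow B M') : ℝ) ≤ T.size (sysPow B (M + M')) := by
    exact_mod_cast size_le_of_iso hfin (sysPowIso B M M').symm
  refine h1.trans ((hsize _).trans (mul_le_mul_of_nonneg_left ?_ hk.le))
  refine (pow_le_pow_left₀ (Nat.cast_nonneg _) (le_max_left _ _) _).trans (b := L ^ (M + M')) ?_
  rw [← Real.log_le_log_iff (by positivity) (by positivity), Real.log_pow, Real.log_pow,
    Real.log_sqrt (by positivity)]
  push_cast
  have hδL : δ * (Real.log L + 1) = Real.log θ / 4 := by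
    rw [hδ]; field_simp
  have hδ0 : 0 ≤ δ := by positivity
  calc ((M : ℝ) + M') * Real.log L ≤ (2 * (δ * N)) * (Real.log L + 1) := by
        refine mul_le_mul (by linarith) (by linarith) hlogL (by positivity)
    _ = N * (2 * (δ * (Real.log L + 1))) := by ring
    _ = N * (Real.log θ / 2) := by rw [hδL]; ring

theorem StronglyCausal.isPure_parState (hT : T.StronglyCausal) (hfin : T.FiniteDimensionalStates)
    (hsc : T.RegularScaling) {A A' B : S} {φ : 𝟙_ S ⟶ A} {ψ : 𝟙_ S ⟶ A'}
    (hφ : T.IsDeterministic φ) (hψ : T.IsDeterministic ψ) (hIφ : T.infoContent B φ = 0)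
    (hIψ : T.infoContent B ψ = 0) : T.IsPure (parState φ ψ) := by
  intro X _ t Z ht i hi
  have := Fintype.ofFinite X
  have hχ : T.IsDeterministic (parState φ ψ) := hφ.parallel hψ
  have hsum : T.stateVec (parState φ ψ) = ∑ x, T.stateVec (t x) := by
    rw [ht.2]
    refine Finset.sum_subset (Finset.subset_univ _) fun x _ hx => ?_
    exact hT.stateVec_eq_zero_of_notMem ht.1 (by rw [ht.sum_prob, hχ.prob_discard]) hx
  refine ⟨T.prob (t i ≫ T.discard _), T.prob_nonneg _, T.prob_le_one _, ?_⟩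
  -- If proportionality fails, some effect `b` witnesses it, and then the joint law `J` differs from
  -- the product of its marginals at that entry.
  funext b
  by_contra hne
  obtain ⟨Y, _, a, y, ha, rfl⟩ := T.event_mem_test b
  have := Fintype.ofFinite Y
  set J : X → Y → ℝ := fun s y => T.prob (t s ≫ a y) with hJ
  have hr : marginalFidelity J < 1 := by
    refine marginalFidelity_lt_one (fun s y => T.prob_nonneg _) ?_ (s := i) (y := y) ?_
    · simp only [hJ, hT.sum_prob_effect _ ha]
      exact ht.1.sum_prob_discard
    · have h1 := congrFun hsum (a y)
      simp only [Finset.sum_apply, stateVec] at h1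
      simp only [hJ, hT.sum_prob_effect _ ha, ← h1]
      exact hne
  -- The 1/2 keeps `r` positive, so that its inverse can serve as a base.
  set r : ℝ := max (marginalFidelity J) (1 / 2)
  have hr1 : r < 1 := max_lt hr (by norm_num)
  have hr0 : 0 < r := lt_of_lt_of_le (by norm_num) (le_max_right _ _)
  have hsr0 : 0 < √r := Real.sqrt_pos.2 hr0
  have hsr1 : √r < 1 := by rw [Real.sqrt_lt' one_pos]; simpa using hr1
  obtain ⟨k, δ, hk, hδ, hsize⟩ := exists_size_sysPow_le hfin hsc B (one_lt_inv_iff₀.2 ⟨hr0, hr1⟩)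
  have hlim : Tendsto (fun N : ℕ => (1 + k) * √r ^ N) atTop (𝓝 ((1 + k) * 0)) :=
    (tendsto_pow_atTop_nhds_zero_of_lt_one hsr0.le hsr1).const_mul _
  rw [mul_zero] at hlim
  obtain ⟨N, ⟨M, hM, ⟨E, D⟩, hED⟩, ⟨M', hM', ⟨E', D'⟩, hED'⟩, hN⟩ :=
    ((exists_reliableScheme_of_infoContent_eq_zero hIφ (ε := 1 / 2) (by norm_num) hδ).and
      ((exists_reliableScheme_of_infoContent_eq_zero hIψ (ε := 1 / 2) (by norm_num) hδ).and
        (hlim.eventually_lt_const (show (0 : ℝ) < 1 / 2 by norm_num)))).exists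
  obtain ⟨X', Y', _, _, t', a', ht', ha', hsum', hf⟩ := exists_test_statePow ht.1 hsum ha N
  -- The threshold θ = r^(-N) balances the two terms: √θ r^N = r^(N/2), and the size, at most k
  -- r^(-N/2), times θ⁻¹ is at most k r^(N/2). With ε = 1/2 the total falls below 1.
  have hθ : 0 < r⁻¹ ^ N := by positivity
  have hmain := hT.one_lt_of_reliableSchemes hfin hφ hψ hED hED' ht' hsum' ha' hθ
  rw [hf] at hmain
  have hsq : √(r⁻¹) = (√r)⁻¹ := Real.sqrt_inv r
  have hsqN : √(r⁻¹ ^ N) = (√r)⁻¹ ^ N := by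
    rw [← hsq, Real.sqrt_eq_iff_mul_self_eq (by positivity) (by positivity), ← mul_pow,
      Real.mul_self_sqrt (by positivity)]
  have hrr : √r * √r = r := Real.mul_self_sqrt hr0.le
  have hone : (√r)⁻¹ * r = √r := by
    rw [inv_mul_eq_iff_eq_mul₀ hsr0.ne', hrr]
  have hfid : √(r⁻¹ ^ N) * marginalFidelity J ^ N ≤ √r ^ N := by
    rw [hsqN, ← mul_pow]
    refine pow_le_pow_left₀ (mul_nonneg (by positivity) (marginalFidelity_nonneg _)) ?_ _
    exact (mul_le_mul_of_nonneg_left (le_max_left _ (1 / 2)) (by positivity)).trans_eq hone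
  have hdim : (T.size (sysPow B M ⊗ sysPow B M') : ℝ) * (r⁻¹ ^ N)⁻¹ ≤ k * √r ^ N := by
    refine (mul_le_mul_of_nonneg_right (hsize N M M' hM hM') (by positivity)).trans_eq ?_
    rw [hsq, ← inv_pow, inv_inv, mul_assoc, ← mul_pow, hone]
  linarith

end OPT

theorem mainTheorem4 {S : Type u} [Category.{v} S] [MonoidalCategory S] [SymmetricCategory S]
    (T : OPT S) (hfin : T.FiniteDimensionalStates) (hclosed : T.ClosedStates)
    (hcausal : T.StronglyCausal) (hscaling : T.RegularScaling) (B : S) (hB : T.IsObit B) :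
    (T.EssentiallyUniquePurification → T.AtomicParallelComposition →
      ∀ (A : S) (φ : 𝟙_ S ⟶ A), T.IsDeterministic φ → T.IsPure φ → T.infoContent B φ = 0) ∧
    ((∀ (A : S) (φ : 𝟙_ S ⟶ A), T.IsDeterministic φ → T.IsPure φ → T.infoContent B φ = 0) →
      T.AtomicParallelComposition) := by
  refine ⟨fun hup hat A φ hφ hpure =>
    hcausal.infoContent_eq_zero hfin hclosed hup hat B hφ hpure, fun h => ?_⟩
  exact hcausal.atomicParallelComposition hclosed fun φ ψ hφ hψ hφp hψp =>
    hcausal.isPure_parState hfin hscaling hφ hψ (h _ φ hφ hφp) (h _ ψ hψ hψp)
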